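/- Notation. $\mathbb{H}_{\mathbb{C}}$ is the algebra of biquaternions $p=p_0+\sum_{k=1}^3p_ke_k$, $p_k\in\mathbb{C}$ (so $e_0=1$, $e_k^2=-1$, $e_1e_2=e_3$ and cyclically, $e_je_k=-e_ke_j$ for $j\ne k$ in $\{1,2,3\}$), with quaternionic conjugation $\overline p=p_0-\sum_{k=1}^3p_ke_k$, inner product $\langle p,q\rangle_{\mathbb{H}_{\mathbb{C}}}=\sum_{k=0}^3p_k^*q_k$ (where $^*$ is complex conjugation) and norm $|p|=\langle p,p\rangle^{1/2}$. Let $G\subset\mathbb{R}^3$ be a bounded domain, $A=(a_1,a_2,a_3,a_4)$ with $a_j\in L_\infty(G;\mathbb{H}_{\mathbb{C}})$, $\mathbf{D}=\sum_{k=1}^3e_k\partial_{x_k}$, and $$\mathbf{Q}_Aw=w\,a_1+\overline{w}\,a_2+a_3\,w+a_4\,\overline{w}.$$ The Vekua-Bergman space $\mathfrak{V}_A^2=\mathfrak{V}_A^2(G;\mathbb{H}_{\mathbb{C}})$ is the space of all $w\in L_2(G;\mathbb{H}_{\mathbb{C}})$ that are weak solutions of $\mathbf{D}w-\mathbf{Q}_Aw=0$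 in $G$, that is, $$\int_G\overline{w}\,(\mathbf{D}\varphi)\,dV=\int_G\overline{\mathbf{Q}_Aw}\,\varphi\,dV\qquad\text{for all }\varphi\in C_0^\infty(G;\mathbb{H}_{\mathbb{C}}),$$ with the inner product $\langle u,v\rangle_{L_2}=\int_G\langle u(x),v(x)\rangle_{\mathbb{H}_{\mathbb{C}}}dV_x$. Proposition. Every $w\in\mathfrak{V}_A^2$ has a continuous representative on $G$, and $w(x)=\sum_{k=0}^3w_k(x)e_k$ denotes its value at $x\in G$. For every $x\in G$ and $k\in\{0,1,2,3\}$ there is a unique $K_x^k\in\mathfrak{V}_A^2$ such that $w_k(x)=\langle K_x^k,w\rangle_{L_2}$ for all $w\in\mathfrak{V}_A^2$. The Vekua-Bergman kernel with coefficient $a=\sum_{j=0}^3a_je_j\in\mathbb{H}_{\mathbb{C}}$ ($a_j\in\mathbb{C}$) is defined by $$\mathscr{K}_G^A(x,t;a)=\sum_{j=0}^3K_t^j(x)\,a_j,\qquad x,t\in G.$$ For every orthonormal basis $\{\varphi_n\}_n$ of $\mathfrak{V}_A^2$, every $t\in G$ and every $a\in\mathbb{H}_{\mathbb{C}}$, the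 function $\mathscr{K}_G^A(\cdot,t;a)$ is in $L_2(G;\mathbb{H}_{\mathbb{C}})$ and $$\mathscr{K}_G^A(x,t;a)=\sum_{n}\langle\varphi_n(t),a\rangle_{\mathbb{H}_{\mathbb{C}}}\,\varphi_n(x),$$ where the series converges, in the variable $x$, in the norm of $L_2(G;\mathbb{H}_{\mathbb{C}})$ and uniformly on every compact subset of $G$ (in both cases unconditionally, that is, along the net of finite partial sums, hence for every enumeration $\sum_{n=0}^\infty$ of the basis). -/

import Mathlib

open MeasureTheory Filter Topology
open scoped ContDiff ENNReal

noncomputable section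

namespace Vekua

/-- Euclidean three-space. -/
abbrev E3 : Type := EuclideanSpace ℝ (Fin 3)

/-- The underlying complex inner product space of the biquaternions: `p = ∑ k, p k • e_k`, with
`⟪p, q⟫ = ∑ k, conj (p k) * q k` (conjugate-linear in the first slot) and the associated norm. -/
abbrev BiQ : Type := EuclideanSpace ℂ (Fin 4)

/-- The biquaternionic product
`p q = p₀ q₀ + p₀ q⃗ + q₀ p⃗ - p⃗ ⬝ q⃗ + p⃗ × q⃗`. -/
def bmul (p q : BiQ) : BiQ :=
  !₂[p 0 * q 0 - (p 1 * q 1 + p 2 * q 2 + p 3 * q 3),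
     p 0 * q 1 + q 0 * p 1 + (p 2 * q 3 - p 3 * q 2),
     p 0 * q 2 + q 0 * p 2 + (p 3 * q 1 - p 1 * q 3),
     p 0 * q 3 + q 0 * p 3 + (p 1 * q 2 - p 2 * q 1)]

/-- Quaternionic conjugation `p ↦ p₀ - p⃗` (complex linear). -/
def bconj (p : BiQ) : BiQ := !₂[p 0, -p 1, -p 2, -p 3]

/-- The unit `e_k`, with `e_0 = 1`. -/
def qunit (k : Fin 4) : BiQ := EuclideanSpace.single k 1

/-- The identification with Mathlib's quaternion algebra over `ℂ`. -/
def toQuaternion (p : BiQ) : QuaternionAlgebra ℂ (-1) 0 (-1) := ⟨p 0, p 1, p 2, p 3⟩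

theorem toQuaternion_bmul (p q : BiQ) :
    toQuaternion (bmul p q) = toQuaternion p * toQuaternion q := by
  ext <;> simp [toQuaternion, bmul] <;> ring

theorem toQuaternion_bconj (p : BiQ) :
    toQuaternion (bconj p) = star (toQuaternion p) := by
  ext <;> simp [toQuaternion, bconj]

/-- The product as a bounded bilinear map. -/
def bmulL : BiQ →L[ℂ] BiQ →L[ℂ] BiQ :=
  LinearMap.toContinuousLinearMap
    ((LinearMap.toContinuousLinearMap : (BiQ →ₗ[ℂ] BiQ) ≃ₗ[ℂ] (BiQ →L[ℂ] BiQ)).toLinearMap ∘ₗ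
      LinearMap.mk₂ ℂ bmul
        (by intro p p' q; ext i; fin_cases i <;> simp [bmul] <;> ring)
        (by intro c p q; ext i; fin_cases i <;> simp [bmul] <;> ring)
        (by intro p q q'; ext i; fin_cases i <;> simp [bmul] <;> ring)
        (by intro c p q; ext i; fin_cases i <;> simp [bmul] <;> ring))

theorem bmulL_apply (p q : BiQ) : bmulL p q = bmul p q := rfl

/-- Conjugation as a bounded linear map. -/
def bconjL : BiQ →L[ℂ] BiQ :=
  LinearMap.toContinuousLinearMap
    { toFun := bconj
      map_add' := by intro p q; ext i; fin_cases i <;> simp [bconj] <;> ring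
      map_smul' := by intro c p; ext i; fin_cases i <;> simp [bconj] }

theorem bconjL_apply (p : BiQ) : bconjL p = bconj p := rfl

/-- The Moisil-Theodorescu operator `D u = e₁ ∂₁ u + e₂ ∂₂ u + e₃ ∂₃ u` on smooth functions. -/
def dirac (u : E3 → BiQ) (x : E3) : BiQ :=
  ∑ k : Fin 3, bmul (qunit k.succ) (fderiv ℝ u x (EuclideanSpace.single k 1))

/-- Test functions: the class `C_0^∞(G; ℍ_ℂ)`. -/
def IsTest (G : Set E3) (φ : E3 → BiQ) : Prop :=
  ContDiff ℝ ∞ φ ∧ HasCompactSupport φ ∧ tsupport φ ⊆ G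

/-- The Hilbert space `L_2(G; ℍ_ℂ)`. -/
abbrev L2 (G : Set E3) : Type := Lp BiQ 2 (volume.restrict G)

/-- The space `L_∞(G; ℍ_ℂ)`. -/
abbrev Linf (G : Set E3) : Type := Lp BiQ ∞ (volume.restrict G)

/-- `Q_A w = w a₁ + conj w a₂ + a₃ w + a₄ conj w`, where `A = (a₁, a₂, a₃, a₄)`. -/
def vekuaQ (A : Fin 4 → E3 → BiQ) (w : E3 → BiQ) (x : E3) : BiQ :=
  bmul (w x) (A 0 x) + bmul (bconj (w x)) (A 1 x)
    + bmul (A 2 x) (w x) + bmul (A 3 x) (bconj (w x))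

/-- `v` is the weak `D`-derivative of `u` on `G`:
`∫_G conj u (D φ) = ∫_G conj v φ` for all test functions `φ`. -/
def IsWeakDirac (G : Set E3) (u v : E3 → BiQ) : Prop :=
  ∀ φ : E3 → BiQ, IsTest G φ →
    ∫ x in G, bmul (bconj (u x)) (dirac φ x) = ∫ x in G, bmul (bconj (v x)) (φ x)

theorem IsTest.memLp {G : Set E3} {φ : E3 → BiQ} (h : IsTest G φ) :
    MemLp φ 2 (volume.restrict G) :=
  (h.1.continuous.memLp_of_hasCompactSupport h.2.1).restrict G

theorem IsTest.dirac_memLp {G : Set E3} {φ : E3 → BiQ} (h : IsTest G φ) :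
    MemLp (dirac φ) 2 (volume.restrict G) := by
  have h1 : ∀ k : Fin 3, MemLp
      (fun x => bmul (qunit k.succ) (fderiv ℝ φ x (EuclideanSpace.single k 1))) 2
      (volume.restrict G) := by
    intro k
    have hc : Continuous (fun x => fderiv ℝ φ x (EuclideanSpace.single k 1)) :=
      (h.1.continuous_fderiv (by simp)).clm_apply continuous_const
    have hs : HasCompactSupport (fun x => fderiv ℝ φ x (EuclideanSpace.single k 1)) :=
      h.2.1.fderiv_apply ℝ _
    have := (hc.memLp_of_hasCompactSupport (p := 2) (μ := volume) hs).restrict G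
    exact (bmulL (qunit k.succ)).comp_memLp' this
  exact memLp_finsetSum _ fun k _ => h1 k

theorem integrable_bmul {μ : Measure E3} {f g : E3 → BiQ} (hf : MemLp f 2 μ) (hg : MemLp g 2 μ) :
    Integrable (fun x => bmul (bconj (f x)) (g x)) μ := by
  have hf' : MemLp (fun x => bconjL (f x)) 2 μ := bconjL.comp_memLp' hf
  exact memLp_one_iff_integrable.1 (bmulL.memLp_of_bilin 1 hf' hg)

theorem memLp_vekuaQ {G : Set E3} (A : Fin 4 → Linf G) (w : L2 G) :
    MemLp (vekuaQ (fun j => A j) w) 2 (volume.restrict G) := by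
  have hw := Lp.memLp w
  have hw' : MemLp (fun x => bconjL (w x)) 2 (volume.restrict G) := bconjL.comp_memLp' hw
  have hA := fun j => Lp.memLp (A j)
  exact (((bmulL.memLp_of_bilin 2 hw (hA 0)).add (bmulL.memLp_of_bilin 2 hw' (hA 1))).add
    (bmulL.memLp_of_bilin 2 (hA 2) hw)).add (bmulL.memLp_of_bilin 2 (hA 3) hw')

/-- The Vekua-Bergman space: all `w ∈ L_2(G; ℍ_ℂ)` that are weak solutions of
`D w - Q_A w = 0` in `G`, i.e. the weak `D`-derivative of `w` is `Q_A w`. -/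
def bergmanSpace {G : Set E3} (A : Fin 4 → Linf G) : Submodule ℂ (L2 G) where
  carrier := {w | IsWeakDirac G w (vekuaQ (fun j => A j) w)}
  zero_mem' := by
    intro φ _
    have h0 : ((0 : L2 G) : E3 → BiQ) =ᵐ[volume.restrict G] 0 := Lp.coeFn_zero _ _ _
    refine integral_congr_ae ?_
    filter_upwards [h0] with x hx
    simp only [vekuaQ, hx, ← bmulL_apply, ← bconjL_apply]
    simp
  add_mem' := by
    intro u v hu hv φ hφ
    have hφ' := hφ.memLp
    have hd := hφ.dirac_memLp
    have huv := Lp.coeFn_add u v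
    calc ∫ x in G, bmul (bconj ((u + v : L2 G) x)) (dirac φ x)
        = ∫ x in G, (bmul (bconj (u x)) (dirac φ x) + bmul (bconj (v x)) (dirac φ x)) := by
          refine integral_congr_ae ?_
          filter_upwards [huv] with x hx
          simp only [hx, Pi.add_apply, ← bmulL_apply, ← bconjL_apply, map_add,
            add_apply]
      _ = ∫ x in G, (bmul (bconj (vekuaQ (fun j => A j) u x)) (φ x)
            + bmul (bconj (vekuaQ (fun j => A j) v x)) (φ x)) := by
          rw [integral_add (integrable_bmul (Lp.memLp u) hd) (integrable_bmul (Lp.memLp v) hd),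
            integral_add (integrable_bmul (memLp_vekuaQ A u) hφ')
              (integrable_bmul (memLp_vekuaQ A v) hφ'), hu φ hφ, hv φ hφ]
      _ = ∫ x in G, bmul (bconj (vekuaQ (fun j => A j) (u + v : L2 G) x)) (φ x) := by
          refine integral_congr_ae ?_
          filter_upwards [huv] with x hx
          simp only [vekuaQ, hx, Pi.add_apply, ← bmulL_apply, ← bconjL_apply, map_add,
            add_apply]
          abel
  smul_mem' := by
    intro c u hu φ hφ
    have hcu := Lp.coeFn_smul c u
    calc ∫ x in G, bmul (bconj ((c • u : L2 G) x)) (dirac φ x)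
        = ∫ x in G, c • bmul (bconj (u x)) (dirac φ x) := by
          refine integral_congr_ae ?_
          filter_upwards [hcu] with x hx
          simp only [hx, Pi.smul_apply, ← bmulL_apply, ← bconjL_apply, map_smul,
            smul_apply]
      _ = ∫ x in G, c • bmul (bconj (vekuaQ (fun j => A j) u x)) (φ x) := by
          rw [integral_smul, integral_smul, hu φ hφ]
      _ = ∫ x in G, bmul (bconj (vekuaQ (fun j => A j) (c • u : L2 G) x)) (φ x) := by
          refine integral_congr_ae ?_
          filter_upwards [hcu] with x hx
          simp only [vekuaQ, hx, Pi.smul_apply, ← bmulL_apply, ← bconjL_apply, map_smul,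
            smul_apply, smul_add, map_add, add_apply]

theorem mem_bergmanSpace {G : Set E3} (A : Fin 4 → Linf G) (w : L2 G) :
    w ∈ bergmanSpace A ↔ IsWeakDirac G w (vekuaQ (fun j => A j) w) := Iff.rfl

/-- `f` is a continuous representative on `G` of the class `w`. -/
def IsContRep (G : Set E3) (w : L2 G) (f : E3 → BiQ) : Prop :=
  ContinuousOn f G ∧ (w : E3 → BiQ) =ᵐ[volume.restrict G] f

open Classical in
/-- The value `w(x)`, `x ∈ G`, of the continuous representative of `w`. -/
def value {G : Set E3} (w : L2 G) (x : E3) : BiQ :=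
  if h : ∃ f, IsContRep G w f then h.choose x else 0

/-- The value at a point does not depend on the chosen continuous representative. -/
theorem value_eq {G : Set E3} (hG : IsOpen G) {w : L2 G} {f : E3 → BiQ} (hf : IsContRep G w f)
    {x : E3} (hx : x ∈ G) : value w x = f x := by
  have h : ∃ f, IsContRep G w f := ⟨f, hf⟩
  rw [value, dif_pos h]
  exact Measure.eqOn_open_of_ae_eq (h.choose_spec.2.symm.trans hf.2) hG h.choose_spec.1 hf.1 hx

/-- `K` represents the functional `w ↦ w_k(x)` on the Bergman space:
`w_k(x) = ⟪K, w⟫` for all `w`. -/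
def Represents {G : Set E3} (A : Fin 4 → Linf G) (x : E3) (k : Fin 4)
    (K : bergmanSpace A) : Prop :=
  ∀ w : bergmanSpace A, value (w : L2 G) x k = inner ℂ K w

open Classical in
/-- The element `K_x^k` of the Bergman space that represents `w ↦ w_k(x)`. -/
def repKernel {G : Set E3} (A : Fin 4 → Linf G) (x : E3) (k : Fin 4) : bergmanSpace A :=
  if h : ∃ K, Represents A x k K then h.choose else 0

/-- The Vekua-Bergman kernel with coefficient `a`:
`𝒦(x, t; a) = ∑ j, K_t^j(x) a_j`. -/
def bergmanKernel {G : Set E3} (A : Fin 4 → Linf G) (x t : E3) (a : BiQ) : BiQ :=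
  ∑ j : Fin 4, a j • value (repKernel A t j : L2 G) x

end Vekua

end

noncomputable section

namespace Vekua

/-! Everything rests on one interior estimate: near each point of `G` the elements of the Bergman
space are continuous and bounded by a constant times their `L²` norm. Evaluation at `t` is then a
bounded functional. The weak equation survives `L²` limits, so the space is complete and the Riesz
representation theorem supplies the `K_t^j`. For `K = ∑ a_j K_t^j` one has `⟪φ_n, K⟫ = ⟪φ_n(t), a⟫`,
so the claimed series is the Hilbert basis expansion of `K`. The interior estimate, made uniform on
compact sets by a finite cover, turns its `L²` convergence into uniform convergence.

The estimate comes from the Cauchy kernel `z / |z|³`, which inverts `D` up to a constant. The weak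
equation is tested with a cut-off `χ` times a smooth regularisation of the kernel whose Dirac
derivative is an approximate identity. In the limit, the conjugate of `χ w` is a convolution of the
kernel with a source bounded by a multiple of `|w|` (`IsWeakDirac.cauchy_representation`). Hence
`|w|` on a ball is dominated by the potential, with kernel `|z|⁻²`, of `|w|` on a larger ball. In
dimension three one such potential does not map `L²` to `L^∞`, but two in succession do
(`lintegral_lintegral_rieszRoot_le`, `bergman_ae_bound`). Once `w` is locally bounded, a third use
of the representation convolves a bounded source with an integrable kernel, which gives continuity
(`bergman_local_regularity`). -/

/-! ### Biquaternion algebra and the Dirac operator on radial fields -/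

theorem bmul_assoc (p q r : BiQ) : bmul (bmul p q) r = bmul p (bmul q r) := by
  ext i; fin_cases i <;> simp [bmul] <;> ring

theorem bmul_qunit_zero (p : BiQ) : bmul p (qunit 0) = p := by
  ext i; fin_cases i <;> simp [bmul, qunit]

theorem bconj_bconj (p : BiQ) : bconj (bconj p) = p := by
  ext i; fin_cases i <;> simp [bconj]

theorem norm_bconj (p : BiQ) : ‖bconj p‖ = ‖p‖ := by
  simp [EuclideanSpace.norm_eq, Fin.sum_univ_four, bconj]

theorem norm_bmul_le (p q : BiQ) : ‖bmul p q‖ ≤ ‖bmulL‖ * ‖p‖ * ‖q‖ :=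
  bmulL.le_opNorm₂ p q

theorem bmul_sub_left (p q r : BiQ) : bmul (p - q) r = bmul p r - bmul q r := by
  ext i; fin_cases i <;> simp [bmul] <;> ring

theorem bmul_smul_left (c : ℝ) (p q : BiQ) : bmul (c • p) q = c • bmul p q := by
  ext i; fin_cases i <;> simp [bmul] <;> ring

theorem bmul_smul_right (c : ℝ) (p q : BiQ) : bmul p (c • q) = c • bmul p q := by
  ext i; fin_cases i <;> simp [bmul] <;> ring

/-- The embedding of real vectors as purely vectorial biquaternions. -/
def vecL : E3 →L[ℝ] BiQ :=
  ∑ k : Fin 3, (EuclideanSpace.proj k : E3 →L[ℝ] ℝ).smulRight (qunit k.succ)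

theorem vecL_apply (v : E3) : vecL v = !₂[0, (v 0 : ℂ), (v 1 : ℂ), (v 2 : ℂ)] := by
  ext i; fin_cases i <;> simp [vecL, Fin.sum_univ_three, qunit]

theorem norm_vecL (v : E3) : ‖vecL v‖ = ‖v‖ := by
  rw [vecL_apply]
  simp [EuclideanSpace.norm_eq, Fin.sum_univ_four, Fin.sum_univ_three]

theorem bmul_vecL_self (v : E3) : bmul (vecL v) (vecL v) = (-‖v‖ ^ 2) • qunit 0 := by
  rw [vecL_apply, EuclideanSpace.norm_sq_eq, Fin.sum_univ_three]
  ext i; fin_cases i <;> simp [bmul, qunit] <;> ring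

theorem vecL_single (k : Fin 3) : vecL (EuclideanSpace.single k 1) = qunit k.succ := by
  rw [vecL_apply]
  ext i; fin_cases k <;> fin_cases i <;> simp [qunit]

/-- The Moisil-Theodorescu operator on a radial vector field with a scalar factor. -/
theorem dirac_smul_vecL_sub {θ : E3 → ℝ} {g x y : E3} (h : HasGradientAt θ g y) :
    dirac (fun z => θ z • vecL (x - z)) y
      = bmul (vecL g) (vecL (x - y)) + (3 * θ y) • qunit 0 := by
  have h1 : HasFDerivAt (fun z : E3 => vecL (x - z)) (-vecL) y := by
    have := vecL.hasFDerivAt.comp y ((hasFDerivAt_const x y).sub (hasFDerivAt_id y))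
    refine this.congr_fderiv ?_
    ext v; simp
  have h2 := h.hasFDerivAt.smul h1
  have h3 : ∀ k : Fin 3, fderiv ℝ (fun z => θ z • vecL (x - z)) y (EuclideanSpace.single k 1)
      = g k • vecL (x - y) - θ y • qunit k.succ := by
    intro k
    rw [show (fun z => θ z • vecL (x - z)) = (θ • fun z => vecL (x - z)) from rfl, h2.fderiv]
    simp [vecL_single, EuclideanSpace.inner_single_right]
    abel
  simp only [dirac, h3, Fin.sum_univ_three]
  rw [vecL_apply g, vecL_apply]
  ext i; fin_cases i <;> simp [bmul, qunit] <;> ring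

/-! ### The Cauchy kernel and its smooth regularisation -/

/-- The scalar profile of the regularised Cauchy kernel. -/
def cauchyProfile (c : ℝ) (z : E3) : ℝ := c ^ 3 * (1 + ‖c • z‖ ^ 2) ^ (-3 / 2 : ℝ)

/-- The regularised Cauchy kernel, tending to `z / |z|³` as `c → ∞`. -/
def regCauchy (c : ℝ) (z : E3) : BiQ := cauchyProfile c z • vecL z

/-- The Cauchy kernel `z / |z|³`. -/
def cauchy (z : E3) : BiQ := (‖z‖ ^ 3)⁻¹ • vecL z

/-- The Dirac derivative of the regularised Cauchy kernel. -/
def peak (z : E3) : ℝ := 3 * (1 + ‖z‖ ^ 2) ^ (-5 / 2 : ℝ)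

theorem contDiff_cauchyProfile (c : ℝ) : ContDiff ℝ ∞ (cauchyProfile c) := by
  unfold cauchyProfile
  refine contDiff_const.mul (ContDiff.rpow_const_of_ne ?_ fun z => by positivity)
  have h : ContDiff ℝ ∞ (fun z : E3 => c • z) := by fun_prop
  exact contDiff_const.add (h.norm_sq ℝ)

theorem contDiff_regCauchy (c : ℝ) : ContDiff ℝ ∞ (regCauchy c) :=
  (contDiff_cauchyProfile c).smul vecL.contDiff

theorem continuous_peak : Continuous peak := by
  unfold peak
  refine continuous_const.mul (Continuous.rpow_const (by fun_prop) fun z => Or.inl (by positivity))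

theorem peak_pos (z : E3) : 0 < peak z := by unfold peak; positivity

theorem hasGradientAt_cauchyProfile_sub (c : ℝ) (x y : E3) :
    HasGradientAt (fun y => cauchyProfile c (x - y))
      ((3 * c ^ 5 * (1 + ‖c • (x - y)‖ ^ 2) ^ (-5 / 2 : ℝ)) • (x - y)) y := by
  have h1 : HasFDerivAt (fun y : E3 => c • (x - y)) (-(c • ContinuousLinearMap.id ℝ E3)) y := by
    have := ((hasFDerivAt_const (𝕜 := ℝ) x y).sub (hasFDerivAt_id y)).const_smul c
    refine this.congr_fderiv ?_
    ext v; simp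
  have h2 := ((h1.norm_sq.const_add 1).rpow_const (p := (-3 / 2 : ℝ))
    (Or.inl (by positivity))).const_mul (c ^ 3)
  rw [hasGradientAt_iff_hasFDerivAt]
  refine h2.congr_fderiv ?_
  ext v
  rw [show (-3 / 2 - 1 : ℝ) = -5 / 2 by norm_num]
  simp [-map_sub]
  ring

/-- Dropping the `1` in the profile only increases a negative power. The bound is independent of
`c`, which makes it the dominating function for the limit `c → ∞`. At `z = 0` both sides vanish by
the convention `0⁻¹ = 0`. -/
theorem norm_regCauchy_le {c : ℝ} (hc : 0 < c) (z : E3) : ‖regCauchy c z‖ ≤ (‖z‖ ^ 2)⁻¹ := by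
  rw [regCauchy, norm_smul, norm_vecL, cauchyProfile, Real.norm_of_nonneg (by positivity)]
  rcases eq_or_ne z 0 with rfl | hz
  · simp
  have hz' : 0 < ‖z‖ := norm_pos_iff.2 hz
  have h1 : (1 + ‖c • z‖ ^ 2) ^ (-3 / 2 : ℝ) ≤ (‖c • z‖ ^ 2) ^ (-3 / 2 : ℝ) := by
    refine Real.rpow_le_rpow_of_nonpos ?_ (by linarith) (by norm_num)
    rw [norm_smul]
    have := norm_pos_iff.2 hc.ne'
    positivity
  have h2 : (‖c • z‖ ^ 2) ^ (-3 / 2 : ℝ) = (c ^ 3 * ‖z‖ ^ 3)⁻¹ := by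
    rw [norm_smul, Real.norm_of_nonneg hc.le, ← Real.rpow_natCast, ← Real.rpow_mul (by positivity),
      show ((2 : ℕ) : ℝ) * (-3 / 2) = -((3 : ℕ) : ℝ) by norm_num, Real.rpow_neg (by positivity),
      Real.rpow_natCast, mul_pow]
  calc c ^ 3 * (1 + ‖c • z‖ ^ 2) ^ (-3 / 2 : ℝ) * ‖z‖
      ≤ c ^ 3 * (c ^ 3 * ‖z‖ ^ 3)⁻¹ * ‖z‖ := by rw [← h2]; gcongr
    _ = (‖z‖ ^ 2)⁻¹ := by field_simp

theorem norm_cauchy_le (z : E3) : ‖cauchy z‖ ≤ (‖z‖ ^ 2)⁻¹ := by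
  rw [cauchy, norm_smul, norm_vecL, norm_inv, norm_pow, norm_norm]
  rcases eq_or_ne z 0 with rfl | hz
  · simp
  have hz' : 0 < ‖z‖ := norm_pos_iff.2 hz
  exact le_of_eq (by field_simp)

theorem tendsto_regCauchy (z : E3) : Tendsto (fun c => regCauchy c z) atTop (𝓝 (cauchy z)) := by
  rcases eq_or_ne z 0 with rfl | hz
  · simp [regCauchy, cauchy]
  have hz' : 0 < ‖z‖ := norm_pos_iff.2 hz
  refine Tendsto.smul_const ?_ _
  have h1 : Tendsto (fun c : ℝ => ((c⁻¹) ^ 2 + ‖z‖ ^ 2) ^ (-3 / 2 : ℝ)) atTop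
      (𝓝 ((0 ^ 2 + ‖z‖ ^ 2) ^ (-3 / 2 : ℝ))) :=
    ((tendsto_inv_atTop_zero.pow 2).add_const _).rpow_const (Or.inl (by positivity))
  have h2 : (0 ^ 2 + ‖z‖ ^ 2) ^ (-3 / 2 : ℝ) = (‖z‖ ^ 3)⁻¹ := by
    rw [zero_pow two_ne_zero, zero_add, ← Real.rpow_natCast, ← Real.rpow_mul (by positivity),
      show ((2 : ℕ) : ℝ) * (-3 / 2) = -((3 : ℕ) : ℝ) by norm_num, Real.rpow_neg (by positivity),
      Real.rpow_natCast]
  rw [h2] at h1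
  refine h1.congr' ?_
  filter_upwards [eventually_gt_atTop 0] with c hc
  have h3 : 1 + ‖c • z‖ ^ 2 = c ^ 2 * ((c⁻¹) ^ 2 + ‖z‖ ^ 2) := by
    rw [norm_smul, Real.norm_of_nonneg hc.le]; field_simp
  have h4 : (c ^ 2) ^ (-3 / 2 : ℝ) = (c ^ 3)⁻¹ := by
    rw [← Real.rpow_natCast, ← Real.rpow_mul (by positivity),
      show ((2 : ℕ) : ℝ) * (-3 / 2) = -((3 : ℕ) : ℝ) by norm_num, Real.rpow_neg (by positivity),
      Real.rpow_natCast]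
  rw [cauchyProfile, h3, Real.mul_rpow (by positivity) (by positivity), h4]
  field_simp

/-- The product rule for a cut-off times the reflected regularised Cauchy kernel. -/
theorem dirac_smul_regCauchy {χ : E3 → ℝ} (hχ : ContDiff ℝ ∞ χ) (c : ℝ) (x y : E3) :
    dirac (fun z => χ z • regCauchy c (x - z)) y
      = bmul (vecL (gradient χ y)) (regCauchy c (x - y))
        + (c ^ 3 * peak (c • (x - y)) * χ y) • qunit 0 := by
  have h1 := (hχ.differentiable (by simp) y).hasGradientAt
  have h2 := hasGradientAt_cauchyProfile_sub c x y
  have h3 : HasGradientAt (fun z => χ z * cauchyProfile c (x - z))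
      (χ y • ((3 * c ^ 5 * (1 + ‖c • (x - y)‖ ^ 2) ^ (-5 / 2 : ℝ)) • (x - y))
        + cauchyProfile c (x - y) • gradient χ y) y := by
    rw [hasGradientAt_iff_hasFDerivAt] at h1 h2 ⊢
    refine (h1.mul h2).congr_fderiv ?_
    simp only [map_add, map_smul]
  have h4 := dirac_smul_vecL_sub (x := x) h3
  have h5 : (1 + ‖c • (x - y)‖ ^ 2) ^ (-3 / 2 : ℝ)
      = (1 + ‖c • (x - y)‖ ^ 2) * (1 + ‖c • (x - y)‖ ^ 2) ^ (-5 / 2 : ℝ) := by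
    nth_rw 2 [← Real.rpow_one (1 + ‖c • (x - y)‖ ^ 2)]
    rw [← Real.rpow_add (by positivity)]
    norm_num
  have h6 : ‖c • (x - y)‖ ^ 2 = c ^ 2 * ‖x - y‖ ^ 2 := by
    rw [norm_smul, mul_pow, Real.norm_eq_abs, sq_abs]
  -- The divergence of the field contributes `3 (1 + s)` and the radial derivative of the profile
  -- `-3 s`, where `s = |c (x - y)|²`. Their sum is the constant `3`, leaving only the peak.
  have h7 : c ^ 3 * (1 + ‖c • (x - y)‖ ^ 2) ^ (-3 / 2 : ℝ) * 3
      = 3 * c ^ 5 * (1 + ‖c • (x - y)‖ ^ 2) ^ (-5 / 2 : ℝ) * ‖x - y‖ ^ 2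
        + c ^ 3 * peak (c • (x - y)) := by
    rw [h5, peak, h6]; ring
  simp only [regCauchy, smul_smul]
  rw [h4]
  simp only [map_add, map_smul, ← bmulL_apply, add_apply]
  simp only [bmulL_apply, bmul_smul_left, bmul_smul_right, bmul_vecL_self]
  simp only [cauchyProfile]
  match_scalars
  · linear_combination χ y * h7
  · ring

/-! ### The Dirac derivative as an approximate identity -/

theorem integrable_peak : Integrable peak := by
  have h := integrable_rpow_neg_one_add_norm_sq (E := E3) (μ := volume) (r := 5) (by simp; norm_num)
  have h' := h.const_mul 3
  exact h'

/-- The integral is the normalising constant of the Cauchy formula. Its value is never needed, only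
that it can be divided by. -/
theorem integral_peak_pos : 0 < ∫ z, peak z :=
  integral_pos_of_integrable_nonneg_nonzero (x := 0) continuous_peak integrable_peak
    (fun z => (peak_pos z).le) (peak_pos 0).ne'

theorem peak_neg (z : E3) : peak (-z) = peak z := by simp [peak]

/-- Quantifies the decay `o(|z|⁻³)` that the approximate identity theorem requires in dimension
three. Weakening the exponent `-5/2` to `-2` leaves an integer power of `|z|` and still enough
decay. -/
theorem norm_pow_mul_peak_le (z : E3) (hz : z ≠ 0) : ‖z‖ ^ 3 * peak z ≤ 3 * ‖z‖⁻¹ := by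
  have hz' : 0 < ‖z‖ := norm_pos_iff.2 hz
  have h1 : (1 + ‖z‖ ^ 2) ^ (-5 / 2 : ℝ) ≤ (‖z‖ ^ 2) ^ (-2 : ℝ) := by
    calc (1 + ‖z‖ ^ 2) ^ (-5 / 2 : ℝ) ≤ (1 + ‖z‖ ^ 2) ^ (-2 : ℝ) :=
          Real.rpow_le_rpow_of_exponent_le (by nlinarith) (by norm_num)
      _ ≤ (‖z‖ ^ 2) ^ (-2 : ℝ) :=
          Real.rpow_le_rpow_of_nonpos (by positivity) (by linarith) (by norm_num)
  have h2 : (‖z‖ ^ 2) ^ (-2 : ℝ) = (‖z‖ ^ 4)⁻¹ := by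
    rw [Real.rpow_neg (by positivity), Real.rpow_two]; ring
  rw [h2] at h1
  calc ‖z‖ ^ 3 * peak z ≤ ‖z‖ ^ 3 * (3 * (‖z‖ ^ 4)⁻¹) := by unfold peak; gcongr
    _ = 3 * ‖z‖⁻¹ := by field_simp

theorem tendsto_norm_pow_mul_peak :
    Tendsto (fun z : E3 => ‖z‖ ^ 3 * peak z) (Bornology.cobounded E3) (𝓝 0) := by
  have h : Tendsto (fun z : E3 => 3 * ‖z‖⁻¹) (Bornology.cobounded E3) (𝓝 0) := by
    simpa using (tendsto_norm_cobounded_atTop (E := E3)).inv_tendsto_atTop.const_mul 3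
  refine squeeze_zero' (Eventually.of_forall fun z => ?_) ?_ h
  · have := peak_pos z
    positivity
  · filter_upwards [Bornology.eventually_ne_cobounded (0 : E3)] with z hz
    exact norm_pow_mul_peak_le z hz

/-- The dilated peaks are, up to normalisation, an approximate identity. -/
theorem tendsto_integral_peak {ψ : E3 → ℝ} (hψ : Integrable ψ) (hc : Continuous ψ) (y : E3) :
    Tendsto (fun c : ℝ => ∫ x, c ^ 3 * peak (c • (x - y)) * ψ x) atTop
      (𝓝 ((∫ z, peak z) * ψ y)) := by
  have hI := integral_peak_pos
  have h := tendsto_integral_comp_smul_smul_of_integrable' (μ := (volume : Measure E3))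
    (φ := fun z => (∫ z, peak z)⁻¹ * peak z) (g := ψ) (x₀ := y)
    (fun z => mul_nonneg (inv_nonneg.2 hI.le) (peak_pos z).le)
    (by rw [integral_const_mul, inv_mul_cancel₀ hI.ne'])
    (by
      have := tendsto_norm_pow_mul_peak.const_mul (∫ z, peak z)⁻¹
      rw [mul_zero] at this
      refine this.congr fun z => ?_
      simp only [finrank_euclideanSpace, Fintype.card_fin]
      ring)
    hψ hc.continuousAt
  have h' := h.const_mul (∫ z, peak z)
  refine h'.congr fun c => ?_
  rw [← integral_const_mul]
  refine integral_congr_ae (Eventually.of_forall fun x => ?_)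
  simp only [finrank_euclideanSpace, Fintype.card_fin, smul_eq_mul]
  rw [show c • (x - y) = -(c • (y - x)) by rw [← smul_neg, neg_sub], peak_neg]
  field_simp

theorem integrable_dilated_peak {c : ℝ} (hc : 0 < c) (y : E3) :
    Integrable (fun x => c ^ 3 * peak (c • (x - y))) :=
  ((integrable_peak.comp_smul hc.ne').comp_sub_right y).const_mul _

theorem integral_dilated_peak {c : ℝ} (hc : 0 < c) (y : E3) :
    ∫ x, c ^ 3 * peak (c • (x - y)) = ∫ z, peak z := by
  rw [integral_const_mul, integral_sub_right_eq_self (fun x => peak (c • x)) y,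
    Measure.integral_comp_smul]
  simp only [finrank_euclideanSpace, Fintype.card_fin, smul_eq_mul]
  rw [abs_of_pos (by positivity)]
  field_simp

/-- Dilation preserves the mass of the peak, so the bound is uniform in `c` and `y`, as dominated
convergence will need. -/
theorem norm_integral_dilated_peak_le {ψ : E3 → ℝ} {M : ℝ} (hM : ∀ x, ‖ψ x‖ ≤ M) {c : ℝ}
    (hc : 0 < c) (y : E3) :
    ‖∫ x, c ^ 3 * peak (c • (x - y)) * ψ x‖ ≤ (∫ z, peak z) * M := by
  rw [← integral_dilated_peak hc y, ← integral_mul_const]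
  refine norm_integral_le_of_norm_le ((integrable_dilated_peak hc y).mul_const M)
    (Eventually.of_forall fun x => ?_)
  have := peak_pos (c • (x - y))
  rw [norm_mul, Real.norm_of_nonneg (by positivity)]
  exact mul_le_mul_of_nonneg_left (hM x) (by positivity)

/-! ### The potential with kernel `|z|⁻²` and its iterate -/

theorem integrableOn_inv_norm_sq (R : ℝ) :
    IntegrableOn (fun z : E3 => (‖z‖ ^ 2)⁻¹) (Metric.ball 0 R) := by
  rw [integrableOn_fun_norm_addHaar volume (f := fun t : ℝ => (t ^ 2)⁻¹)]
  have : IntegrableOn (fun _ : ℝ => (1 : ℝ)) (Set.Ioo 0 R) := by simp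
  refine this.congr_fun (fun t ht => ?_) measurableSet_Ioo
  have := ht.1
  simp
  field_simp

/-- The cube root of the truncated kernel `1 / |z|²`. -/
def rieszRoot (R : ℝ) : E3 → ℝ≥0∞ :=
  (Metric.ball 0 R).indicator fun z => ENNReal.ofReal (‖z‖ ^ (-2 / 3 : ℝ))

theorem measurable_rieszRoot (R : ℝ) : Measurable (rieszRoot R) := by
  refine Measurable.indicator ?_ measurableSet_ball
  exact (measurable_norm.pow_const _).ennreal_ofReal

theorem rieszRoot_pow_three {R : ℝ} {z : E3} (hz : ‖z‖ < R) :
    rieszRoot R z ^ 3 = ENNReal.ofReal (‖z‖ ^ 2)⁻¹ := by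
  rw [rieszRoot, Set.indicator_of_mem (by simpa using hz), ← ENNReal.ofReal_pow (by positivity),
    ← Real.rpow_natCast, ← Real.rpow_mul (by positivity),
    show (-2 / 3 : ℝ) * (3 : ℕ) = -((2 : ℕ) : ℝ) by norm_num, Real.rpow_neg (by positivity),
    Real.rpow_natCast]

/-- In polar coordinates the integrand is `t^(2 - 8/3) = t^(-2/3)`, integrable at the origin. The
cube root `k` is introduced because `k⁴` is integrable while `k⁶ = |z|⁻⁴`, which a direct
Cauchy–Schwarz estimate of one potential would involve, is not. -/
theorem lintegral_rieszRoot_pow_four_lt_top (R : ℝ) : ∫⁻ z, rieszRoot R z ^ 4 < ⊤ := by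
  have h1 : IntegrableOn (fun z : E3 => ‖z‖ ^ (-8 / 3 : ℝ)) (Metric.ball 0 R) := by
    rw [integrableOn_fun_norm_addHaar volume (f := fun t : ℝ => t ^ (-8 / 3 : ℝ))]
    rcases le_or_gt R 0 with hR | hR
    · simp [Set.Ioo_eq_empty (not_lt.2 hR)]
    have : IntegrableOn (fun t : ℝ => t ^ (-2 / 3 : ℝ)) (Set.Ioo 0 R) :=
      (intervalIntegral.integrableOn_Ioo_rpow_iff hR).2 (by norm_num)
    refine this.congr_fun (fun t ht => ?_) measurableSet_Ioo
    simp only [finrank_euclideanSpace, Fintype.card_fin, smul_eq_mul]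
    rw [← Real.rpow_natCast, ← Real.rpow_add ht.1]
    norm_num
  have h2 : ∀ z : E3, rieszRoot R z ^ 4
      = (Metric.ball 0 R).indicator (fun z => ENNReal.ofReal (‖z‖ ^ (-8 / 3 : ℝ))) z := by
    intro z
    rw [rieszRoot]
    by_cases hz : z ∈ Metric.ball 0 R
    · rw [Set.indicator_of_mem hz, Set.indicator_of_mem hz, ← ENNReal.ofReal_pow (by positivity),
        ← Real.rpow_natCast, ← Real.rpow_mul (by positivity)]
      norm_num
    · rw [Set.indicator_of_notMem hz, Set.indicator_of_notMem hz]
      simp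
  simp_rw [h2]
  rw [lintegral_indicator measurableSet_ball]
  exact h1.lintegral_lt_top

/-- The iterated kernel maps `L²` to bounded functions. -/
theorem lintegral_lintegral_rieszRoot_le (R : ℝ) {u : E3 → ℝ≥0∞} (hu : AEMeasurable u) (x : E3) :
    ∫⁻ y, rieszRoot R (x - y) ^ 3 * ∫⁻ z, rieszRoot R (y - z) ^ 3 * u z
      ≤ (∫⁻ z, rieszRoot R z ^ 4)
        * (2 * (∫⁻ z, rieszRoot R z ^ 4) * ∫⁻ z, u z ^ 2) ^ (1 / 2 : ℝ) := by
  set k := rieszRoot R with hk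
  set M := ∫⁻ z, k z ^ 4 with hM
  have km : Measurable k := measurable_rieszRoot R
  have hk1 : Measurable fun p : E3 × E3 => k (x - p.1) :=
    km.comp (measurable_const.sub measurable_fst)
  have hk2 : Measurable fun p : E3 × E3 => k (p.1 - p.2) :=
    km.comp (measurable_fst.sub measurable_snd)
  have hu2 : AEMeasurable (fun p : E3 × E3 => u p.2) (volume.prod volume) :=
    hu.comp_quasiMeasurePreserving Measure.quasiMeasurePreserving_snd
  have hu3 : AEMeasurable (fun p : E3 × E3 => k (x - p.1) * k (p.1 - p.2) * u p.2)
      (volume.prod volume) := (hk1.mul hk2).aemeasurable.mul hu2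
  have hk3 : AEMeasurable (fun p : E3 × E3 => k (x - p.1) ^ 2 * k (p.1 - p.2) ^ 2)
      (volume.prod volume) := ((hk1.pow_const 2).mul (hk2.pow_const 2)).aemeasurable
  have int1 : ∀ x, ∫⁻ y, k (x - y) ^ 4 = M := fun x =>
    lintegral_sub_left_eq_self (fun y => k y ^ 4) x
  have int2 : ∀ z, ∫⁻ y, k (y - z) ^ 4 = M := fun z =>
    lintegral_sub_right_eq_self (fun y => k y ^ 4) z
  -- By Tonelli this is one double integral, whose integrand `k³ k³ u` is split as `(k² k²) (k k
  -- u)`. After Cauchy–Schwarz only fourth powers of `k` have to be integrated.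
  have e1 : ∫⁻ y, k (x - y) ^ 3 * ∫⁻ z, k (y - z) ^ 3 * u z
      = ∫⁻ p : E3 × E3, ((fun p : E3 × E3 => k (x - p.1) ^ 2 * k (p.1 - p.2) ^ 2)
        * (fun p : E3 × E3 => k (x - p.1) * k (p.1 - p.2) * u p.2)) p ∂(volume.prod volume) := by
    rw [lintegral_prod _ (hk3.mul hu3)]
    refine lintegral_congr fun y => ?_
    rw [← lintegral_const_mul'' _ (by fun_prop)]
    refine lintegral_congr fun z => ?_
    simp only [Pi.mul_apply]
    ring
  have e2 : ∫⁻ p : E3 × E3, (k (x - p.1) ^ 2 * k (p.1 - p.2) ^ 2) ^ (2 : ℝ) ∂(volume.prod volume)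
      = M * M := by
    simp_rw [ENNReal.rpow_two]
    rw [lintegral_prod _ (by fun_prop)]
    have : ∀ y, ∫⁻ z, (k (x - y) ^ 2 * k (y - z) ^ 2) ^ 2 = k (x - y) ^ 4 * M := by
      intro y
      rw [← int1 y, ← lintegral_const_mul _ (by fun_prop)]
      refine lintegral_congr fun z => ?_
      ring
    simp_rw [this]
    rw [lintegral_mul_const _ (by fun_prop), int1]
  have e3 : ∫⁻ p : E3 × E3, (k (x - p.1) * k (p.1 - p.2) * u p.2) ^ (2 : ℝ) ∂(volume.prod volume)
      ≤ 2 * M * ∫⁻ z, u z ^ 2 := by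
    simp_rw [ENNReal.rpow_two]
    rw [lintegral_prod_symm _ (hu3.pow_const 2),
      ← lintegral_const_mul'' _ (hu.pow_const 2)]
    refine lintegral_mono fun z => ?_
    calc ∫⁻ y, (k (x - y) * k (y - z) * u z) ^ 2
        ≤ ∫⁻ y, (k (x - y) ^ 4 + k (y - z) ^ 4) * u z ^ 2 := by
          refine lintegral_mono fun y => ?_
          rw [mul_pow]
          gcongr
          -- The product `k(x - y)² k(y - z)²` is at most the larger of the two fourth powers, hence
          -- at most their sum. Each has integral `M` in `y`, which produces the factor `2 M`.
          rcases le_total (k (x - y)) (k (y - z)) with h | h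
          · calc (k (x - y) * k (y - z)) ^ 2 ≤ (k (y - z) * k (y - z)) ^ 2 := by gcongr
              _ = k (y - z) ^ 4 := by ring
              _ ≤ _ := le_add_self
          · calc (k (x - y) * k (y - z)) ^ 2 ≤ (k (x - y) * k (x - y)) ^ 2 := by gcongr
              _ = k (x - y) ^ 4 := by ring
              _ ≤ _ := le_self_add
      _ = 2 * M * u z ^ 2 := by
          rw [lintegral_mul_const _ (by fun_prop), lintegral_add_left (by fun_prop), int1, int2,
            two_mul]
  rw [e1]
  refine (ENNReal.lintegral_mul_le_Lp_mul_Lq _ Real.HolderConjugate.two_two hk3 hu3).trans ?_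
  rw [e2]
  gcongr
  · rw [← sq, ← ENNReal.rpow_two, ← ENNReal.rpow_mul]
    norm_num

/-! ### Convolution with an integrable kernel -/

/-- The truncated Cauchy kernel. -/
def truncCauchy (R : ℝ) : E3 → BiQ := (Metric.ball 0 R).indicator cauchy

theorem measurable_cauchy : Measurable cauchy := by
  unfold cauchy
  fun_prop

theorem integrable_truncCauchy (R : ℝ) : Integrable (truncCauchy R) := by
  rw [truncCauchy, integrable_indicator_iff measurableSet_ball]
  refine (integrableOn_inv_norm_sq R).mono' measurable_cauchy.aestronglyMeasurable
    (Eventually.of_forall norm_cauchy_le)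

/-- The convolution of a bounded function on a domain of finite measure with an integrable kernel
is continuous. -/
theorem continuous_integral_bmul_sub {μ : Measure E3} [IsFiniteMeasure μ] (hμ : μ ≤ volume)
    {b e : E3 → BiQ} {M : ℝ} (hb : AEStronglyMeasurable b μ) (hM : ∀ᵐ y ∂μ, ‖b y‖ ≤ M)
    (he : Integrable e) : Continuous fun x => ∫ y, bmul (b y) (e (x - y)) ∂μ := by
  have hbi : Integrable b μ := Integrable.of_bound hb M hM
  have hMnn : 0 ≤ |M| := abs_nonneg M
  have hM' : ∀ᵐ y ∂μ, ‖b y‖ ≤ |M| := hM.mono fun y hy => hy.trans (le_abs_self M)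
  have int_e : ∀ {e : E3 → BiQ}, Integrable e → ∀ x,
      Integrable (fun y => bmul (b y) (e (x - y))) μ := by
    intro e he x
    have h1 : Integrable (fun y => e (x - y)) μ := (he.comp_sub_left x).mono_measure hμ
    refine (h1.norm.const_mul (‖bmulL‖ * |M|)).mono'
      (bmulL.aestronglyMeasurable_comp₂ hb h1.aestronglyMeasurable) ?_
    filter_upwards [hM'] with y hy
    exact (norm_bmul_le _ _).trans (by gcongr)
  -- The kernel is approximated in `L¹` by continuous compactly supported ones. As `b` is bounded,
  -- the convolutions converge uniformly, and continuity passes to the limit. The `+ 1` below keeps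
  -- the denominator positive when the bound on `b` is zero.
  refine continuous_of_uniform_approx_of_continuous fun U hU => ?_
  obtain ⟨ε, hε, hεU⟩ := Metric.mem_uniformity_dist.1 hU
  obtain ⟨g, hgs, hge, hgc, hgi⟩ := he.exists_hasCompactSupport_integral_sub_le
    (ε := ε / (2 * (‖bmulL‖ * |M| + 1))) (by positivity)
  obtain ⟨B, hB⟩ := hgs.exists_bound_of_continuous hgc
  refine ⟨fun x => ∫ y, bmul (b y) (g (x - y)) ∂μ, ?_, fun x => hεU ?_⟩
  · refine continuous_of_dominated (bound := fun y => ‖bmulL‖ * ‖b y‖ * B)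
      (fun x => (int_e hgi x).aestronglyMeasurable) (fun x => Eventually.of_forall fun y => ?_)
      ((hbi.norm.const_mul _).mul_const _) (Eventually.of_forall fun y => ?_)
    · exact (norm_bmul_le _ _).trans (by gcongr; exact hB _)
    · exact (bmulL (b y)).continuous.comp (hgc.comp (continuous_id.sub continuous_const))
  · rw [dist_eq_norm, ← integral_sub (int_e he x) (int_e hgi x)]
    have h1 : Integrable (fun y => ‖e (x - y) - g (x - y)‖) volume :=
      ((he.sub hgi).comp_sub_left x).norm
    have h2 : ∫ y, ‖e (x - y) - g (x - y)‖ = ∫ y, ‖e y - g y‖ :=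
      integral_sub_left_eq_self (fun y => ‖e y - g y‖) volume x
    calc ‖∫ y, (bmul (b y) (e (x - y)) - bmul (b y) (g (x - y))) ∂μ‖
        ≤ ∫ y, ‖bmulL‖ * |M| * ‖e (x - y) - g (x - y)‖ ∂μ := by
          refine norm_integral_le_of_norm_le ((h1.mono_measure hμ).const_mul _) ?_
          filter_upwards [hM'] with y hy
          rw [← bmulL_apply, ← bmulL_apply, ← map_sub, bmulL_apply]
          exact (norm_bmul_le _ _).trans (by gcongr)
      _ ≤ ‖bmulL‖ * |M| * ∫ y, ‖e (x - y) - g (x - y)‖ := by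
          rw [integral_const_mul]
          gcongr
          exact Eventually.of_forall fun y => norm_nonneg _
      _ ≤ ‖bmulL‖ * |M| * (ε / (2 * (‖bmulL‖ * |M| + 1))) := by rw [h2]; gcongr
      _ < ε := by
          have : 0 ≤ ‖bmulL‖ * |M| := by positivity
          rw [mul_div_assoc', div_lt_iff₀ (by positivity)]
          nlinarith

/-! ### The Cauchy representation of cut-off weak solutions -/

/-- The source of the cut-off equation `D (χ u) = χ D u + (D χ) u`, in conjugated form. -/
def cutSource (χ : E3 → ℝ) (u v : E3 → BiQ) (y : E3) : BiQ :=
  χ y • bconj (v y) - bmul (bconj (u y)) (vecL (gradient χ y))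

theorem continuous_gradient {χ : E3 → ℝ} (hχ : ContDiff ℝ ∞ χ) : Continuous (gradient χ) :=
  (InnerProductSpace.toDual ℝ E3).symm.continuous.comp (hχ.continuous_fderiv (by simp))

theorem hasCompactSupport_gradient {χ : E3 → ℝ} (hs : HasCompactSupport χ) :
    HasCompactSupport (gradient χ) :=
  (hs.fderiv ℝ).comp_left (map_zero (InnerProductSpace.toDual ℝ E3).symm)

theorem memLp_bconj {μ : Measure E3} {f : E3 → BiQ} (hf : MemLp f 2 μ) :
    MemLp (fun x => bconj (f x)) 2 μ :=
  bconjL.comp_memLp' hf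

theorem memLp_smul_of_continuous {μ : Measure E3} {f : E3 → BiQ} (hf : MemLp f 2 μ) {χ : E3 → ℝ}
    (hχ : Continuous χ) (hs : HasCompactSupport χ) : MemLp (fun x => χ x • f x) 2 μ := by
  obtain ⟨B, hB⟩ := hs.exists_bound_of_continuous hχ
  refine hf.of_le_mul (c := B) (hχ.aestronglyMeasurable.smul hf.1) (Eventually.of_forall fun x => ?_)
  rw [norm_smul]
  gcongr
  exact hB x

theorem memLp_bmul_of_continuous {μ : Measure E3} {f : E3 → BiQ} (hf : MemLp f 2 μ) {g : E3 → BiQ}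
    (hg : Continuous g) (hs : HasCompactSupport g) : MemLp (fun x => bmul (f x) (g x)) 2 μ := by
  obtain ⟨B, hB⟩ := hs.exists_bound_of_continuous hg
  refine hf.of_le_mul (c := ‖bmulL‖ * B)
    (bmulL.aestronglyMeasurable_comp₂ hf.1 hg.aestronglyMeasurable)
    (Eventually.of_forall fun x => ?_)
  calc ‖bmul (f x) (g x)‖ ≤ ‖bmulL‖ * ‖f x‖ * ‖g x‖ := norm_bmul_le _ _
    _ ≤ ‖bmulL‖ * ‖f x‖ * B := by gcongr; exact hB x
    _ = ‖bmulL‖ * B * ‖f x‖ := by ring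

theorem memLp_cutSource {μ : Measure E3} {χ : E3 → ℝ} (hχ : ContDiff ℝ ∞ χ)
    (hs : HasCompactSupport χ) {u v : E3 → BiQ} (hu : MemLp u 2 μ) (hv : MemLp v 2 μ) :
    MemLp (cutSource χ u v) 2 μ :=
  (memLp_smul_of_continuous (memLp_bconj hv) hχ.continuous hs).sub
    (memLp_bmul_of_continuous (memLp_bconj hu) (vecL.continuous.comp (continuous_gradient hχ))
      ((hasCompactSupport_gradient hs).comp_left (map_zero vecL)))

/-- The weak equation tested with a cut-off regularised Cauchy kernel. -/
theorem IsWeakDirac.regCauchy_identity {G : Set E3} {u v : E3 → BiQ} (h : IsWeakDirac G u v)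
    (hu : MemLp u 2 (volume.restrict G)) (hv : MemLp v 2 (volume.restrict G)) {χ : E3 → ℝ}
    (hχ : ContDiff ℝ ∞ χ) (hs : HasCompactSupport χ) (hG : tsupport χ ⊆ G) (c : ℝ) (x : E3) :
    ∫ y in G, (c ^ 3 * peak (c • (x - y))) • (χ y • bconj (u y))
      = ∫ y in G, bmul (cutSource χ u v y) (regCauchy c (x - y)) := by
  have hrc : ContDiff ℝ ∞ fun z => regCauchy c (x - z) :=
    (contDiff_regCauchy c).comp (contDiff_const.sub contDiff_id)
  -- The regularised kernel is smooth across `y = x`, so its product with `χ` is an admissible test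
  -- function for every `x`, without excising a ball around the singularity.
  have htest : IsTest G (fun z => χ z • regCauchy c (x - z)) :=
    ⟨hχ.smul hrc, hs.smul_right, (closure_mono (Function.support_smul_subset_left _ _)).trans hG⟩
  have hgs : HasCompactSupport fun y => vecL (gradient χ y) :=
    (hasCompactSupport_gradient hs).comp_left (map_zero vecL)
  have hgc : Continuous fun y => vecL (gradient χ y) :=
    vecL.continuous.comp (continuous_gradient hχ)
  have hkc : Continuous fun y => bmul (vecL (gradient χ y)) (regCauchy c (x - y)) :=
    bmulL.continuous₂.comp (hgc.prodMk hrc.continuous)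
  have hks : HasCompactSupport fun y => bmul (vecL (gradient χ y)) (regCauchy c (x - y)) := by
    refine hgs.mono fun y hy h0 => hy ?_
    simp only [h0, ← bmulL_apply, map_zero, zero_apply]
  have i1 := integrable_bmul hu ((hkc.memLp_of_hasCompactSupport (p := 2) (μ := volume) hks).restrict G)
  have i2 := integrable_bmul hv htest.memLp
  have hpc : Continuous fun y => (c ^ 3 * peak (c • (x - y)) * χ y) • qunit 0 := by
    have := continuous_peak.comp ((continuous_const.sub continuous_id).const_smul c :
      Continuous fun y : E3 => c • (x - y))
    exact ((continuous_const.mul this).mul hχ.continuous).smul continuous_const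
  have hps : HasCompactSupport fun y => (c ^ 3 * peak (c • (x - y)) * χ y) • qunit 0 :=
    (hs.mul_left).smul_right
  have i3 := integrable_bmul hu ((hpc.memLp_of_hasCompactSupport (p := 2) (μ := volume) hps).restrict G)
  have key := h _ htest
  simp_rw [dirac_smul_regCauchy hχ, ← bmulL_apply, map_add, bmulL_apply] at key
  rw [integral_add i1 i3] at key
  have e3 : ∀ y, bmul (bconj (u y)) ((c ^ 3 * peak (c • (x - y)) * χ y) • qunit 0)
      = (c ^ 3 * peak (c • (x - y))) • (χ y • bconj (u y)) := by
    intro y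
    rw [bmul_smul_right, bmul_qunit_zero, smul_smul]
  simp_rw [e3] at key
  rw [← sub_eq_iff_eq_add'.2 key.symm, ← integral_sub i2 i1]
  -- By associativity the gradient of `χ` moves from the test function onto `bconj u`, so both
  -- remaining terms share the right factor `regCauchy` and combine into `cutSource`.
  refine integral_congr_ae (Eventually.of_forall fun y => ?_)
  simp only [cutSource]
  rw [bmul_smul_right, ← bmul_assoc, ← bmul_smul_left, ← bmul_sub_left]

/-- `F` is merely integrable, so the limit `c → ∞` is taken after pairing with a continuous `ψ`. On
the left, Fubini transfers the approximate identity from `F` to `ψ`; on the right, dominated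
convergence applies on the product space. Truncation at `R` changes nothing for `x, y ∈ G`, and it
makes the kernel integrable on all of space. -/
theorem regCauchy_identity_pairing {G : Set E3} (hGo : IsOpen G) {R : ℝ}
    (hR : ∀ x ∈ G, ∀ y ∈ G, ‖x - y‖ < R) {F S : E3 → BiQ}
    (hF : Integrable F (volume.restrict G)) (hS : Integrable S (volume.restrict G))
    (h : ∀ c : ℝ, 0 < c → ∀ x, ∫ y in G, (c ^ 3 * peak (c • (x - y))) • F y
      = ∫ y in G, bmul (S y) (regCauchy c (x - y)))
    {ψ : E3 → ℝ} (hψ : Continuous ψ) (hψs : HasCompactSupport ψ) (hψG : tsupport ψ ⊆ G) :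
    ∫ y in G, ψ y • ((∫ z, peak z) • F y)
      = ∫ x, ψ x • ∫ y in G, bmul (S y) (truncCauchy R (x - y)) := by
  set ν : Measure E3 := volume.restrict G with hν
  obtain ⟨B, hB⟩ := hψs.exists_bound_of_continuous hψ
  have hψi : Integrable ψ := hψ.integrable_of_hasCompactSupport hψs
  have lim1 : Tendsto (fun c : ℝ => ∫ x, ψ x • ∫ y, (c ^ 3 * peak (c • (x - y))) • F y ∂ν) atTop
      (𝓝 (∫ y, ψ y • ((∫ z, peak z) • F y) ∂ν)) := by
    have e : ∀ᶠ c : ℝ in atTop, ∫ y, (∫ x, c ^ 3 * peak (c • (x - y)) * ψ x) • F y ∂ν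
        = ∫ x, ψ x • ∫ y, (c ^ 3 * peak (c • (x - y))) • F y ∂ν := by
      filter_upwards [eventually_gt_atTop 0] with c hc
      have hm : Continuous fun p : E3 × E3 => c ^ 3 * peak (c • (p.1 - p.2)) :=
        continuous_const.mul (continuous_peak.comp ((continuous_fst.sub continuous_snd).const_smul c))
      have hint : Integrable (fun p : E3 × E3 =>
          (c ^ 3 * peak (c • (p.1 - p.2)) * ψ p.1) • F p.2) (volume.prod ν) := by
        refine ((hψi.norm.mul_prod hF.norm).const_mul (c ^ 3 * 3)).mono'
          ((hm.mul (hψ.comp continuous_fst)).aestronglyMeasurable.smul hF.1.comp_snd)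
          (Eventually.of_forall fun p => ?_)
        -- A crude bound at fixed `c`, used only to justify Fubini.
        have h1 : peak (c • (p.1 - p.2)) ≤ 3 := by
          unfold peak
          have := Real.rpow_le_one_of_one_le_of_nonpos
            (show 1 ≤ 1 + ‖c • (p.1 - p.2)‖ ^ 2 by nlinarith [sq_nonneg ‖c • (p.1 - p.2)‖])
            (show (-5 / 2 : ℝ) ≤ 0 by norm_num)
          linarith
        have h2 := peak_pos (c • (p.1 - p.2))
        rw [norm_smul, norm_mul, Real.norm_of_nonneg (by positivity), mul_assoc]
        gcongr
      have := integral_integral_swap (f := fun x y => (c ^ 3 * peak (c • (x - y)) * ψ x) • F y) hint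
      simp_rw [integral_smul_const] at this
      rw [← this]
      refine integral_congr_ae (Eventually.of_forall fun x => ?_)
      simp only
      rw [← integral_smul]
      refine integral_congr_ae (Eventually.of_forall fun y => ?_)
      simp only [smul_smul]
      rw [mul_comm]
    refine Tendsto.congr' e ?_
    refine tendsto_integral_filter_of_dominated_convergence
      (fun y => (∫ z, peak z) * B * ‖F y‖) ?_ ?_ (hF.norm.const_mul _) ?_
    · filter_upwards with c
      have hm : Continuous fun p : E3 × E3 => c ^ 3 * peak (c • (p.2 - p.1)) * ψ p.2 :=
        (continuous_const.mul (continuous_peak.comp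
          ((continuous_snd.sub continuous_fst).const_smul c))).mul (hψ.comp continuous_snd)
      exact (hm.stronglyMeasurable.integral_prod_right
        (f := fun y x => c ^ 3 * peak (c • (x - y)) * ψ x)).aestronglyMeasurable.smul hF.1
    · filter_upwards [eventually_gt_atTop 0] with c hc
      refine Eventually.of_forall fun y => ?_
      rw [norm_smul]
      gcongr
      exact norm_integral_dilated_peak_le hB hc y
    · refine Eventually.of_forall fun y => ?_
      have := (tendsto_integral_peak hψi hψ y).smul_const (F y)
      rwa [mul_comm, mul_smul] at this
  have intT : Integrable (fun p : E3 × E3 => ψ p.1 • bmul (S p.2) (truncCauchy R (p.1 - p.2)))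
      (volume.prod ν) :=
    (hS.convolution_integrand bmulL (integrable_truncCauchy R)).bdd_smul B
      (hψ.comp continuous_fst).aestronglyMeasurable (Eventually.of_forall fun p => by exact hB p.1)
  have hκ : Integrable ((Metric.ball (0 : E3) R).indicator fun z => (‖z‖ ^ 2)⁻¹) :=
    (integrable_indicator_iff measurableSet_ball).2 (integrableOn_inv_norm_sq R)
  have intB : Integrable (fun p : E3 × E3 => ψ p.1 • (‖bmulL‖ * (‖S p.2‖
      * (Metric.ball (0 : E3) R).indicator (fun z => (‖z‖ ^ 2)⁻¹) (p.1 - p.2)))) (volume.prod ν) :=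
    ((hS.norm.convolution_integrand (ContinuousLinearMap.mul ℝ ℝ) hκ).const_mul _).bdd_smul B
      (hψ.comp continuous_fst).aestronglyMeasurable (Eventually.of_forall fun p => by exact hB p.1)
  have hmem : ∀ᵐ p : E3 × E3 ∂(volume.prod ν), p.2 ∈ G :=
    Measure.quasiMeasurePreserving_snd.ae (ae_restrict_mem hGo.measurableSet)
  have hψ0 : ∀ x, x ∉ G → ψ x = 0 := fun x hx => image_eq_zero_of_notMem_tsupport fun h => hx (hψG h)
  -- The majorant does not involve `c`. Either `ψ` vanishes at the first point or both points lie in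
  -- `G`, within the truncation radius.
  have hbound : ∀ c : ℝ, 0 < c → ∀ᵐ p : E3 × E3 ∂(volume.prod ν),
      ‖ψ p.1 • bmul (S p.2) (regCauchy c (p.1 - p.2))‖ ≤ ‖ψ p.1 • (‖bmulL‖ * (‖S p.2‖
      * (Metric.ball (0 : E3) R).indicator (fun z => (‖z‖ ^ 2)⁻¹) (p.1 - p.2)))‖ := by
    intro c hc
    filter_upwards [hmem] with p hp
    by_cases hp1 : p.1 ∈ G
    · rw [norm_smul, norm_smul]
      gcongr
      refine le_trans ?_ (le_abs_self _)
      rw [Set.indicator_of_mem (by simpa using hR _ hp1 _ hp), ← mul_assoc]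
      refine (norm_bmul_le _ _).trans ?_
      gcongr
      exact norm_regCauchy_le hc _
    · simp [hψ0 _ hp1]
  have hmeas : ∀ c : ℝ, AEStronglyMeasurable
      (fun p : E3 × E3 => ψ p.1 • bmul (S p.2) (regCauchy c (p.1 - p.2))) (volume.prod ν) := fun c =>
    (hψ.comp continuous_fst).aestronglyMeasurable.smul (bmulL.aestronglyMeasurable_comp₂
      hS.1.comp_snd ((contDiff_regCauchy c).continuous.comp
        (continuous_fst.sub continuous_snd)).aestronglyMeasurable)
  have lim2 : Tendsto (fun c : ℝ => ∫ x, ψ x • ∫ y, bmul (S y) (regCauchy c (x - y)) ∂ν) atTop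
      (𝓝 (∫ x, ψ x • ∫ y, bmul (S y) (truncCauchy R (x - y)) ∂ν)) := by
    have e : ∀ᶠ c : ℝ in atTop,
        ∫ p : E3 × E3, ψ p.1 • bmul (S p.2) (regCauchy c (p.1 - p.2)) ∂(volume.prod ν)
        = ∫ x, ψ x • ∫ y, bmul (S y) (regCauchy c (x - y)) ∂ν := by
      filter_upwards [eventually_gt_atTop 0] with c hc
      rw [integral_prod _ (intB.norm.mono' (hmeas c) (hbound c hc))]
      simp_rw [integral_smul]
    refine Tendsto.congr' e ?_
    have e2 : ∫ x, ψ x • ∫ y, bmul (S y) (truncCauchy R (x - y)) ∂ν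
        = ∫ p : E3 × E3, ψ p.1 • bmul (S p.2) (truncCauchy R (p.1 - p.2)) ∂(volume.prod ν) := by
      rw [integral_prod _ intT]
      simp_rw [integral_smul]
    rw [e2]
    refine tendsto_integral_filter_of_dominated_convergence _ (Eventually.of_forall hmeas) ?_
      intB.norm ?_
    · filter_upwards [eventually_gt_atTop 0] with c hc using hbound c hc
    · filter_upwards [hmem] with p hp
      by_cases hp1 : p.1 ∈ G
      · rw [truncCauchy, Set.indicator_of_mem (by simpa using hR _ hp1 _ hp)]
        exact (((bmulL (S p.2)).continuous.tendsto _).comp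
          (tendsto_regCauchy (p.1 - p.2))).const_smul _
      · simp [hψ0 _ hp1]
  refine tendsto_nhds_unique lim1 (lim2.congr' ?_)
  filter_upwards [eventually_gt_atTop 0] with c hc
  refine integral_congr_ae (Eventually.of_forall fun x => ?_)
  exact congrArg (ψ x • ·) (h c hc x).symm

/-- The fundamental lemma of the calculus of variations. Integrating over `G` or over the whole
space makes no difference, since `ψ` vanishes off `G`. -/
theorem ae_eq_of_setIntegral_smul_eq {G : Set E3} (hGo : IsOpen G) {f g : E3 → BiQ}
    (hf : IntegrableOn f G) (hg : IntegrableOn g G)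
    (h : ∀ ψ : E3 → ℝ, ContDiff ℝ ∞ ψ → HasCompactSupport ψ → tsupport ψ ⊆ G →
      ∫ x in G, ψ x • f x = ∫ x, ψ x • g x) : ∀ᵐ x, x ∈ G → f x = g x := by
  have hdiff : IntegrableOn (fun x => f x - g x) G := hf.sub hg
  have key := hGo.ae_eq_zero_of_integral_contDiff_smul_eq_zero hdiff.locallyIntegrableOn
  refine (key fun ψ hψ hψs hψG => ?_).mono fun x hx hxG => sub_eq_zero.1 (hx hxG)
  have hψ0 : ∀ x, x ∉ G → ψ x = 0 := fun x hx => image_eq_zero_of_notMem_tsupport fun h => hx (hψG h)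
  obtain ⟨B, hB⟩ := hψs.exists_bound_of_continuous hψ.continuous
  have i1 : Integrable (fun x => ψ x • f x) (volume.restrict G) :=
    hf.bdd_smul B hψ.continuous.aestronglyMeasurable (Eventually.of_forall hB)
  have i2 : Integrable (fun x => ψ x • g x) (volume.restrict G) :=
    hg.bdd_smul B hψ.continuous.aestronglyMeasurable (Eventually.of_forall hB)
  rw [← setIntegral_eq_integral_of_forall_compl_eq_zero (s := G)
    (fun x hx => by rw [hψ0 x hx, zero_smul])]
  simp_rw [smul_sub]
  rw [integral_sub i1 i2, h ψ hψ hψs hψG, setIntegral_eq_integral_of_forall_compl_eq_zero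
      (fun x hx => by rw [hψ0 x hx, zero_smul]), sub_self]

theorem integrable_integral_bmul_sub {ν : Measure E3} [SFinite ν] {b e : E3 → BiQ}
    (hb : Integrable b ν) (he : Integrable e) :
    Integrable fun x => ∫ y, bmul (b y) (e (x - y)) ∂ν := by
  have h : Integrable (fun p : E3 × E3 => bmul (b p.2) (e (p.1 - p.2))) (volume.prod ν) :=
    hb.convolution_integrand bmulL he
  exact h.integral_prod_left

/-- The Cauchy integral representation of a cut-off weak solution. -/
theorem IsWeakDirac.cauchy_representation {G : Set E3} (hGo : IsOpen G)
    [IsFiniteMeasure (volume.restrict G)] {R : ℝ}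
    (hR : ∀ x ∈ G, ∀ y ∈ G, ‖x - y‖ < R) {u v : E3 → BiQ} (h : IsWeakDirac G u v)
    (hu : MemLp u 2 (volume.restrict G)) (hv : MemLp v 2 (volume.restrict G)) {χ : E3 → ℝ}
    (hχ : ContDiff ℝ ∞ χ) (hs : HasCompactSupport χ) (hG : tsupport χ ⊆ G) :
    ∀ᵐ x, x ∈ G → (∫ z, peak z) • (χ x • bconj (u x))
      = ∫ y in G, bmul (cutSource χ u v y) (truncCauchy R (x - y)) := by
  have hF : Integrable (fun y => χ y • bconj (u y)) (volume.restrict G) :=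
    (memLp_smul_of_continuous (memLp_bconj hu) hχ.continuous hs).integrable one_le_two
  have hS : Integrable (cutSource χ u v) (volume.restrict G) :=
    (memLp_cutSource hχ hs hu hv).integrable one_le_two
  have hconv : Integrable fun x => ∫ y in G, bmul (cutSource χ u v y) (truncCauchy R (x - y)) :=
    integrable_integral_bmul_sub hS (integrable_truncCauchy R)
  have hF' : Integrable (fun x => (∫ z, peak z) • (χ x • bconj (u x))) (volume.restrict G) :=
    hF.smul (∫ z, peak z)
  exact ae_eq_of_setIntegral_smul_eq hGo hF' hconv.integrableOn fun ψ hψ hψs hψG =>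
    regCauchy_identity_pairing hGo hR hF hS
      (fun c _ x => h.regCauchy_identity hu hv hχ hs hG c x) hψ.continuous hψs hψG

/-! ### Interior estimates -/

theorem exists_ae_norm_le {G : Set E3} (a : Linf G) :
    ∃ B : ℝ, ∀ᵐ x ∂(volume.restrict G), ‖a x‖ ≤ B := by
  refine ⟨‖a‖, ?_⟩
  have h := ae_le_eLpNormEssSup (f := a) (μ := volume.restrict G)
  filter_upwards [h] with x hx
  rw [← toReal_enorm, Lp.norm_def, eLpNorm_exponent_top]
  exact ENNReal.toReal_mono (by simpa using (Lp.memLp a).2.ne) hx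

theorem exists_ae_norm_vekuaQ_le {G : Set E3} (A : Fin 4 → Linf G) :
    ∃ C : ℝ, 0 ≤ C ∧ ∀ w : L2 G, ∀ᵐ x ∂(volume.restrict G),
      ‖vekuaQ (fun j => A j) w x‖ ≤ C * ‖w x‖ := by
  choose B hB using fun j => exists_ae_norm_le (A j)
  refine ⟨‖bmulL‖ * ∑ j, |B j|, by positivity, fun w => ?_⟩
  filter_upwards [ae_all_iff.2 hB] with x hx
  have hx' : ∀ j, ‖A j x‖ ≤ |B j| := fun j => (hx j).trans (le_abs_self _)
  have left : ∀ p : BiQ, ‖p‖ = ‖w x‖ → ∀ j, ‖bmul p (A j x)‖ ≤ ‖bmulL‖ * |B j| * ‖w x‖ := by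
    intro p hp j
    refine (norm_bmul_le _ _).trans ?_
    rw [hp, mul_right_comm]
    gcongr
    exact hx' j
  have right : ∀ p : BiQ, ‖p‖ = ‖w x‖ → ∀ j, ‖bmul (A j x) p‖ ≤ ‖bmulL‖ * |B j| * ‖w x‖ := by
    intro p hp j
    refine (norm_bmul_le _ _).trans ?_
    rw [hp]
    gcongr
    exact hx' j
  have hc := norm_bconj (w x)
  calc ‖vekuaQ (fun j => A j) w x‖
      ≤ ‖bmul (w x) (A 0 x)‖ + ‖bmul (bconj (w x)) (A 1 x)‖ + ‖bmul (A 2 x) (w x)‖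
        + ‖bmul (A 3 x) (bconj (w x))‖ := norm_add₄_le
    _ ≤ ‖bmulL‖ * |B 0| * ‖w x‖ + ‖bmulL‖ * |B 1| * ‖w x‖ + ‖bmulL‖ * |B 2| * ‖w x‖
        + ‖bmulL‖ * |B 3| * ‖w x‖ := by
        gcongr
        exacts [left _ rfl 0, left _ hc 1, right _ rfl 2, right _ hc 3]
    _ = (‖bmulL‖ * ∑ j, |B j|) * ‖w x‖ := by rw [Fin.sum_univ_four]; ring

theorem cutSource_eq_zero {χ : E3 → ℝ} {u v : E3 → BiQ} {y : E3} (hy : y ∉ tsupport χ) :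
    cutSource χ u v y = 0 := by
  have h1 : χ y = 0 := image_eq_zero_of_notMem_tsupport hy
  have h2 : gradient χ y = 0 := by
    have := image_eq_zero_of_notMem_tsupport (fun h => hy (tsupport_fderiv_subset ℝ h))
    rw [gradient, this, map_zero]
  rw [cutSource, h1, h2, zero_smul, map_zero, ← bmulL_apply, map_zero, sub_zero]

/-- The source contains no derivative of `w`: the equation has replaced `D w` by `Q_A w`, which is
of order zero with bounded coefficients. This is what allows the representation to be iterated. -/
theorem exists_ae_norm_cutSource_le {G : Set E3} (A : Fin 4 → Linf G) {χ : E3 → ℝ}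
    (hχ : ContDiff ℝ ∞ χ) (hs : HasCompactSupport χ) {U : Set E3} (hU : tsupport χ ⊆ U) :
    ∃ C : ℝ, 0 ≤ C ∧ ∀ w : L2 G, ∀ᵐ x ∂(volume.restrict G),
      ‖cutSource χ w (vekuaQ (fun j => A j) w) x‖ ≤ C * U.indicator (fun x => ‖w x‖) x := by
  obtain ⟨C, hC0, hC⟩ := exists_ae_norm_vekuaQ_le A
  obtain ⟨B, hB⟩ := hs.exists_bound_of_continuous hχ.continuous
  obtain ⟨D, hD⟩ := (hasCompactSupport_gradient hs).exists_bound_of_continuous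
    (continuous_gradient hχ)
  have hB0 : 0 ≤ B := (norm_nonneg _).trans (hB 0)
  have hD0 : 0 ≤ D := (norm_nonneg _).trans (hD 0)
  refine ⟨B * C + ‖bmulL‖ * D, by positivity, fun w => ?_⟩
  filter_upwards [hC w] with x hx
  by_cases hxU : x ∈ U
  · rw [Set.indicator_of_mem hxU]
    calc ‖cutSource χ w (vekuaQ (fun j => A j) w) x‖
        ≤ ‖χ x • bconj (vekuaQ (fun j => A j) w x)‖
          + ‖bmul (bconj (w x)) (vecL (gradient χ x))‖ := norm_sub_le _ _
      _ ≤ B * (C * ‖w x‖) + ‖bmulL‖ * ‖w x‖ * D := by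
          refine add_le_add ?_ ((norm_bmul_le _ _).trans ?_)
          · rw [norm_smul, norm_bconj]
            gcongr
            exact hB x
          · rw [norm_bconj, norm_vecL]
            gcongr
            exact hD x
      _ = (B * C + ‖bmulL‖ * D) * ‖w x‖ := by ring
  · rw [cutSource_eq_zero (fun h => hxU (hU h)), Set.indicator_of_notMem hxU]
    simp

theorem exists_cutoff (x₀ : E3) {r : ℝ} (hr : 0 < r) :
    ∃ χ : E3 → ℝ, ContDiff ℝ ∞ χ ∧ HasCompactSupport χ ∧ tsupport χ ⊆ Metric.ball x₀ r ∧
      ∀ x ∈ Metric.ball x₀ (r / 2), χ x = 1 := by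
  let b : ContDiffBump x₀ := ⟨r / 2, 3 * r / 4, by linarith, by linarith⟩
  refine ⟨b, b.contDiff, b.hasCompactSupport, ?_, fun x hx =>
    b.one_of_mem_closedBall (Metric.ball_subset_closedBall hx)⟩
  rw [b.tsupport_eq]
  exact Metric.closedBall_subset_ball (by simp only [b]; linarith)

theorem enorm_truncCauchy_le (R : ℝ) (z : E3) : ‖truncCauchy R z‖ₑ ≤ rieszRoot R z ^ 3 := by
  by_cases hz : z ∈ Metric.ball 0 R
  · rw [rieszRoot_pow_three (by simpa using hz), truncCauchy, Set.indicator_of_mem hz,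
      ← ofReal_norm]
    exact ENNReal.ofReal_le_ofReal (norm_cauchy_le z)
  · rw [truncCauchy, Set.indicator_of_notMem hz]
    simp

/-- Norms are taken in the Cauchy representation for a cut-off equal to `1` on the half ball. The
price of each application is a factor two in the radius. -/
theorem bergman_potential_bound {G : Set E3} (hGo : IsOpen G)
    [IsFiniteMeasure (volume.restrict G)] {R : ℝ} (hR : ∀ x ∈ G, ∀ y ∈ G, ‖x - y‖ < R)
    (A : Fin 4 → Linf G) {x₀ : E3} {r : ℝ} (hr : 0 < r) (hrG : Metric.ball x₀ r ⊆ G) :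
    ∃ C : ℝ≥0∞, C ≠ ⊤ ∧ ∀ w ∈ bergmanSpace A, ∀ᵐ x, x ∈ Metric.ball x₀ (r / 2) →
      ‖w x‖ₑ ≤ C * ∫⁻ y, rieszRoot R (x - y) ^ 3
        * (Metric.ball x₀ r).indicator (fun y => ‖w y‖ₑ) y := by
  obtain ⟨χ, hχ, hs, hsupp, hone⟩ := exists_cutoff x₀ hr
  obtain ⟨C, hC0, hC⟩ := exists_ae_norm_cutSource_le A hχ hs hsupp
  have hI := integral_peak_pos
  refine ⟨‖(∫ z, peak z)⁻¹‖ₑ * (‖bmulL‖ₑ * ENNReal.ofReal C), by finiteness, fun w hw => ?_⟩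
  have hrep := IsWeakDirac.cauchy_representation hGo hR ((mem_bergmanSpace A w).1 hw) (Lp.memLp w)
    (memLp_vekuaQ A w) hχ hs (hsupp.trans hrG)
  filter_upwards [hrep] with x hx hxV
  have hxU : x ∈ Metric.ball x₀ r := Metric.ball_subset_ball (by linarith) hxV
  have e1 : bconj (w x) = (∫ z, peak z)⁻¹ • ∫ y in G,
      bmul (cutSource χ w (vekuaQ (fun j => A j) w) y) (truncCauchy R (x - y)) := by
    rw [← hx (hrG hxU), hone x hxV, one_smul, smul_smul, inv_mul_cancel₀ hI.ne', one_smul]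
  have e2 : ‖w x‖ₑ = ‖bconj (w x)‖ₑ := by
    rw [← ofReal_norm, ← ofReal_norm, norm_bconj]
  rw [e2, e1, enorm_smul, mul_assoc]
  gcongr
  refine (enorm_integral_le_lintegral_enorm _).trans ?_
  rw [← lintegral_const_mul' _ _ (by finiteness)]
  refine le_trans (lintegral_mono_ae ?_) (setLIntegral_le_lintegral G _)
  filter_upwards [hC w] with y hy
  have h1 : ‖bmul (cutSource χ w (vekuaQ (fun j => A j) w) y) (truncCauchy R (x - y))‖ₑ
      ≤ ‖bmulL‖ₑ * ‖cutSource χ w (vekuaQ (fun j => A j) w) y‖ₑ * ‖truncCauchy R (x - y)‖ₑ := by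
    simp only [← ofReal_norm]
    rw [← ENNReal.ofReal_mul (norm_nonneg _), ← ENNReal.ofReal_mul (by positivity)]
    exact ENNReal.ofReal_le_ofReal (norm_bmul_le _ _)
  have h2 : ‖cutSource χ w (vekuaQ (fun j => A j) w) y‖ₑ
      ≤ ENNReal.ofReal C * (Metric.ball x₀ r).indicator (fun y => ‖w y‖ₑ) y := by
    rw [← ofReal_norm]
    refine (ENNReal.ofReal_le_ofReal hy).trans ?_
    rw [ENNReal.ofReal_mul hC0]
    gcongr
    by_cases hyU : y ∈ Metric.ball x₀ r <;> simp [hyU]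
  calc _ ≤ _ := h1
    _ ≤ ‖bmulL‖ₑ * (ENNReal.ofReal C * (Metric.ball x₀ r).indicator (fun y => ‖w y‖ₑ) y)
        * rieszRoot R (x - y) ^ 3 := by
        gcongr
        exact enorm_truncCauchy_le R _
    _ = _ := by ring

/-- The potential bound is used twice, from radius `r` to `r/2` and from `r/2` to `r/4`. Inserting
the first into the second gives an iterated potential, which is bounded by the `L²` norm. -/
theorem bergman_ae_bound {G : Set E3} (hGo : IsOpen G)
    [IsFiniteMeasure (volume.restrict G)] {R : ℝ} (hR : ∀ x ∈ G, ∀ y ∈ G, ‖x - y‖ < R)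
    (A : Fin 4 → Linf G) {x₀ : E3} {r : ℝ} (hr : 0 < r) (hrG : Metric.ball x₀ r ⊆ G) :
    ∃ C : ℝ, 0 ≤ C ∧ ∀ w ∈ bergmanSpace A, ∀ᵐ x, x ∈ Metric.ball x₀ (r / 4) →
      ‖w x‖ ≤ C * ‖w‖ := by
  have hr2 : Metric.ball x₀ (r / 2) ⊆ G :=
    (Metric.ball_subset_ball (by linarith)).trans hrG
  obtain ⟨C₁, hC₁, h₁⟩ := bergman_potential_bound hGo hR A (half_pos hr) hr2
  obtain ⟨C₂, hC₂, h₂⟩ := bergman_potential_bound hGo hR A hr hrG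
  set M := ∫⁻ z, rieszRoot R z ^ 4 with hM
  have hMtop : M ≠ ⊤ := (lintegral_rieszRoot_pow_four_lt_top R).ne
  set K := C₁ * (C₂ * (M * (2 * M) ^ (1 / 2 : ℝ))) with hK
  have hKtop : K ≠ ⊤ := by
    have : (2 * M) ^ (1 / 2 : ℝ) ≠ ⊤ := ENNReal.rpow_ne_top_of_nonneg (by norm_num) (by finiteness)
    finiteness
  refine ⟨K.toReal, ENNReal.toReal_nonneg, fun w hw => ?_⟩
  set u : E3 → ℝ≥0∞ := (Metric.ball x₀ r).indicator (fun y => ‖w y‖ₑ) with hu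
  have hum : AEMeasurable u :=
    (aemeasurable_indicator_iff measurableSet_ball).2
      ((Lp.aestronglyMeasurable w).enorm.mono_measure (Measure.restrict_mono hrG le_rfl))
  have hu2 : (∫⁻ z, u z ^ 2) ^ (1 / 2 : ℝ) ≤ ‖w‖ₑ := by
    rw [Lp.enorm_def, eLpNorm_eq_lintegral_rpow_enorm_toReal (by simp) (by simp)]
    simp only [ENNReal.toReal_ofNat, ENNReal.rpow_two]
    refine ENNReal.rpow_le_rpow ?_ (by norm_num)
    rw [← lintegral_indicator hGo.measurableSet]
    refine lintegral_mono fun z => ?_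
    by_cases hz : z ∈ Metric.ball x₀ r
    · simp [hu, hz, hrG hz]
    · simp [hu, hz]
  have h₂' : ∀ᵐ y, (Metric.ball x₀ (r / 2)).indicator (fun y => ‖w y‖ₑ) y
      ≤ C₂ * ∫⁻ z, rieszRoot R (y - z) ^ 3 * u z := by
    filter_upwards [h₂ w hw] with y hy
    by_cases hyV : y ∈ Metric.ball x₀ (r / 2)
    · rw [Set.indicator_of_mem hyV]
      exact hy hyV
    · rw [Set.indicator_of_notMem hyV]
      exact zero_le
  filter_upwards [h₁ w hw] with x hx hxV
  have hxV' : x ∈ Metric.ball x₀ (r / 2 / 2) := by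
    rwa [show r / 2 / 2 = r / 4 by ring]
  have main : ‖w x‖ₑ ≤ K * ‖w‖ₑ := by
    calc ‖w x‖ₑ ≤ C₁ * ∫⁻ y, rieszRoot R (x - y) ^ 3
          * (Metric.ball x₀ (r / 2)).indicator (fun y => ‖w y‖ₑ) y := hx hxV'
      _ ≤ C₁ * ∫⁻ y, C₂ * (rieszRoot R (x - y) ^ 3 * ∫⁻ z, rieszRoot R (y - z) ^ 3 * u z) := by
          refine mul_le_mul_right ?_ _
          refine lintegral_mono_ae ?_
          filter_upwards [h₂'] with y hy
          rw [mul_left_comm]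
          gcongr
      _ ≤ C₁ * (C₂ * (M * (2 * M * ∫⁻ z, u z ^ 2) ^ (1 / 2 : ℝ))) := by
          rw [lintegral_const_mul' _ _ hC₂]
          gcongr
          exact lintegral_lintegral_rieszRoot_le R hum x
      _ ≤ C₁ * (C₂ * (M * ((2 * M) ^ (1 / 2 : ℝ) * ‖w‖ₑ))) := by
          rw [ENNReal.mul_rpow_of_nonneg _ _ (by norm_num)]
          gcongr
      _ = K * ‖w‖ₑ := by rw [hK]; ring
  have := ENNReal.toReal_mono (by finiteness) main
  rwa [ENNReal.toReal_mul, toReal_enorm, toReal_enorm] at this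

/-- Interior regularity: elements of the Bergman space are locally bounded by their norm and
locally continuous. -/
theorem bergman_local_regularity {G : Set E3} (hGo : IsOpen G)
    [IsFiniteMeasure (volume.restrict G)] {R : ℝ} (hR : ∀ x ∈ G, ∀ y ∈ G, ‖x - y‖ < R)
    (A : Fin 4 → Linf G) {x₀ : E3} (hx₀ : x₀ ∈ G) :
    ∃ ρ > 0, Metric.ball x₀ ρ ⊆ G ∧ ∃ C : ℝ, 0 ≤ C ∧ ∀ w ∈ bergmanSpace A,
      (∀ᵐ x, x ∈ Metric.ball x₀ ρ → ‖w x‖ ≤ C * ‖w‖) ∧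
      ∃ f : E3 → BiQ, Continuous f ∧ ∀ᵐ x, x ∈ Metric.ball x₀ ρ → w x = f x := by
  obtain ⟨r, hr, hrG⟩ := Metric.isOpen_iff.1 hGo x₀ hx₀
  obtain ⟨C, hC0, hC⟩ := bergman_ae_bound hGo hR A hr hrG
  have hr4 : Metric.ball x₀ (r / 4) ⊆ G :=
    (Metric.ball_subset_ball (by linarith)).trans hrG
  have hr8 : Metric.ball x₀ (r / 4 / 2) ⊆ Metric.ball x₀ (r / 4) :=
    Metric.ball_subset_ball (by linarith)
  refine ⟨r / 4 / 2, by positivity, hr8.trans hr4, C, hC0, fun w hw => ⟨?_, ?_⟩⟩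
  · filter_upwards [hC w hw] with x hx hxV using hx (hr8 hxV)
  obtain ⟨χ, hχ, hs, hsupp, hone⟩ := exists_cutoff x₀ (show 0 < r / 4 by positivity)
  obtain ⟨B, hB0, hB⟩ := exists_ae_norm_cutSource_le A hχ hs hsupp
  have hI := integral_peak_pos
  have hrep := IsWeakDirac.cauchy_representation hGo hR ((mem_bergmanSpace A w).1 hw) (Lp.memLp w)
    (memLp_vekuaQ A w) hχ hs (hsupp.trans hr4)
  -- The new cut-off is supported where `w` is already known to be bounded, so the source is bounded
  -- as well.
  have hSb : ∀ᵐ y ∂(volume.restrict G),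
      ‖cutSource χ w (vekuaQ (fun j => A j) w) y‖ ≤ B * (C * ‖w‖) := by
    filter_upwards [hB w, ae_restrict_of_ae (hC w hw)] with y hy hy'
    refine hy.trans ?_
    gcongr
    by_cases hyV : y ∈ Metric.ball x₀ (r / 4)
    · rw [Set.indicator_of_mem hyV]
      exact hy' hyV
    · rw [Set.indicator_of_notMem hyV]
      positivity
  have hcont := continuous_integral_bmul_sub Measure.restrict_le_self
    (memLp_cutSource hχ hs (Lp.memLp w) (memLp_vekuaQ A w)).1 hSb (integrable_truncCauchy R)
  refine ⟨fun x => bconjL ((∫ z, peak z)⁻¹ • ∫ y in G,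
    bmul (cutSource χ w (vekuaQ (fun j => A j) w) y) (truncCauchy R (x - y))),
    bconjL.continuous.comp (hcont.const_smul (∫ z, peak z)⁻¹), ?_⟩
  filter_upwards [hrep] with x hx hxV
  rw [← hx (hr4 (hr8 hxV)), hone x hxV, one_smul, smul_smul, inv_mul_cancel₀ hI.ne', one_smul,
    bconjL_apply, bconj_bconj]

/-! ### Closedness of the Bergman space -/

theorem exists_integral_norm_le (G : Set E3) [IsFiniteMeasure (volume.restrict G)] :
    ∃ C : ℝ, 0 ≤ C ∧ ∀ v : L2 G, ∫ x in G, ‖v x‖ ≤ C * ‖v‖ := by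
  refine ⟨((volume.restrict G) Set.univ ^ (1 / 2 : ℝ)).toReal, ENNReal.toReal_nonneg, fun v => ?_⟩
  have h := eLpNorm_le_eLpNorm_mul_rpow_measure_univ (μ := volume.restrict G) (p := 1) (q := 2)
    one_le_two (Lp.aestronglyMeasurable v)
  have e : (1 / (1 : ℝ≥0∞).toReal - 1 / (2 : ℝ≥0∞).toReal) = 1 / 2 := by norm_num
  rw [e, eLpNorm_one_eq_lintegral_enorm, ← Lp.enorm_def, mul_comm] at h
  rw [integral_norm_eq_lintegral_enorm (Lp.aestronglyMeasurable v), ← toReal_enorm,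
    ← ENNReal.toReal_mul]
  refine ENNReal.toReal_mono (ENNReal.mul_ne_top ?_ (by finiteness)) h
  exact ENNReal.rpow_ne_top_of_nonneg (by norm_num) (measure_ne_top _ _)

theorem norm_setIntegral_bmul_le {G : Set E3} [IsFiniteMeasure (volume.restrict G)] {B C : ℝ}
    (hC0 : 0 ≤ C) {f g : E3 → BiQ} {v : L2 G} (hg : ∀ x, ‖g x‖ ≤ B)
    (hf : ∀ᵐ x ∂(volume.restrict G), ‖f x‖ ≤ C * ‖v x‖) :
    ‖∫ x in G, bmul (bconj (f x)) (g x)‖ ≤ ‖bmulL‖ * C * B * ∫ x in G, ‖v x‖ := by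
  rw [← integral_const_mul]
  refine norm_integral_le_of_norm_le
    (((Lp.memLp v).integrable one_le_two).norm.const_mul _) ?_
  filter_upwards [hf] with x hx
  calc ‖bmul (bconj (f x)) (g x)‖ ≤ ‖bmulL‖ * ‖f x‖ * ‖g x‖ := by
        simpa only [norm_bconj] using norm_bmul_le (bconj (f x)) (g x)
    _ ≤ ‖bmulL‖ * (C * ‖v x‖) * B := by gcongr; exact hg x
    _ = ‖bmulL‖ * C * B * ‖v x‖ := by ring

theorem IsTest.continuous_dirac {G : Set E3} {φ : E3 → BiQ} (h : IsTest G φ) :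
    Continuous (dirac φ) := by
  refine continuous_finsetSum _ fun k _ => (bmulL (qunit k.succ)).continuous.comp ?_
  exact (h.1.continuous_fderiv (by simp)).clm_apply continuous_const

theorem IsTest.hasCompactSupport_dirac {G : Set E3} {φ : E3 → BiQ} (h : IsTest G φ) :
    HasCompactSupport (dirac φ) := by
  refine (h.2.1.fderiv ℝ).mono fun x hx h0 => hx ?_
  simp only [dirac, h0, zero_apply, ← bmulL_apply, map_zero, Finset.sum_const_zero]

theorem vekuaQ_sub_ae {G : Set E3} (A : Fin 4 → Linf G) (u v : L2 G) :
    ∀ᵐ x ∂(volume.restrict G), vekuaQ (fun j => A j) (u - v : L2 G) x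
      = vekuaQ (fun j => A j) u x - vekuaQ (fun j => A j) v x := by
  filter_upwards [Lp.coeFn_sub u v] with x hx
  simp only [vekuaQ, hx, Pi.sub_apply, ← bmulL_apply, ← bconjL_apply, map_sub, sub_apply]
  abel

/-- The defect of the weak equation, tested with `φ`. -/
def weakDefect {G : Set E3} (A : Fin 4 → Linf G) (φ : E3 → BiQ) (w : L2 G) : BiQ :=
  (∫ x in G, bmul (bconj (w x)) (dirac φ x))
    - ∫ x in G, bmul (bconj (vekuaQ (fun j => A j) w x)) (φ x)

theorem weakDefect_sub {G : Set E3} (A : Fin 4 → Linf G) {φ : E3 → BiQ} (hφ : IsTest G φ)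
    (u v : L2 G) : weakDefect A φ (u - v) = weakDefect A φ u - weakDefect A φ v := by
  have e1 : ∫ x in G, bmul (bconj ((u - v : L2 G) x)) (dirac φ x)
      = (∫ x in G, bmul (bconj (u x)) (dirac φ x)) - ∫ x in G, bmul (bconj (v x)) (dirac φ x) := by
    rw [← integral_sub (integrable_bmul (Lp.memLp u) hφ.dirac_memLp)
      (integrable_bmul (Lp.memLp v) hφ.dirac_memLp)]
    refine integral_congr_ae ?_
    filter_upwards [Lp.coeFn_sub u v] with x hx
    simp only [hx, Pi.sub_apply, ← bmulL_apply, ← bconjL_apply, map_sub, sub_apply]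
  have e2 : ∫ x in G, bmul (bconj (vekuaQ (fun j => A j) (u - v : L2 G) x)) (φ x)
      = (∫ x in G, bmul (bconj (vekuaQ (fun j => A j) u x)) (φ x))
        - ∫ x in G, bmul (bconj (vekuaQ (fun j => A j) v x)) (φ x) := by
    rw [← integral_sub (integrable_bmul (memLp_vekuaQ A u) hφ.memLp)
      (integrable_bmul (memLp_vekuaQ A v) hφ.memLp)]
    refine integral_congr_ae ?_
    filter_upwards [vekuaQ_sub_ae A u v] with x hx
    simp only [hx, ← bmulL_apply, ← bconjL_apply, map_sub, sub_apply]
  rw [weakDefect, e1, e2, weakDefect, weakDefect]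
  abel

/-- The test function and its Dirac derivative are bounded and `|Q_A w| ≤ C |w|`, so the defect is
controlled by the `L¹` norm. On a set of finite measure this is controlled by the `L²` norm, and
additivity makes the bound a Lipschitz estimate. -/
theorem continuous_weakDefect {G : Set E3} [IsFiniteMeasure (volume.restrict G)]
    (A : Fin 4 → Linf G) {φ : E3 → BiQ} (hφ : IsTest G φ) : Continuous (weakDefect A φ) := by
  obtain ⟨B₁, hB₁⟩ := hφ.hasCompactSupport_dirac.exists_bound_of_continuous hφ.continuous_dirac
  obtain ⟨B₂, hB₂⟩ := hφ.2.1.exists_bound_of_continuous hφ.1.continuous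
  obtain ⟨C, hC0, hC⟩ := exists_ae_norm_vekuaQ_le A
  obtain ⟨D, hD0, hD⟩ := exists_integral_norm_le G
  have hB₁0 : 0 ≤ B₁ := (norm_nonneg _).trans (hB₁ 0)
  have hB₂0 : 0 ≤ B₂ := (norm_nonneg _).trans (hB₂ 0)
  refine (LipschitzWith.of_dist_le_mul
    (K := ((‖bmulL‖ * 1 * B₁ + ‖bmulL‖ * C * B₂) * D).toNNReal) fun u v => ?_).continuous
  rw [dist_eq_norm, dist_eq_norm, ← weakDefect_sub A hφ, Real.coe_toNNReal _ (by positivity)]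
  calc ‖weakDefect A φ (u - v)‖
      ≤ ‖bmulL‖ * 1 * B₁ * (∫ x in G, ‖(u - v : L2 G) x‖)
        + ‖bmulL‖ * C * B₂ * ∫ x in G, ‖(u - v : L2 G) x‖ :=
        (norm_sub_le _ _).trans (add_le_add
          (norm_setIntegral_bmul_le zero_le_one hB₁ (Eventually.of_forall fun x => by rw [one_mul]))
          (norm_setIntegral_bmul_le hC0 hB₂ (hC _)))
    _ = (‖bmulL‖ * 1 * B₁ + ‖bmulL‖ * C * B₂) * ∫ x in G, ‖(u - v : L2 G) x‖ := by ring
    _ ≤ (‖bmulL‖ * 1 * B₁ + ‖bmulL‖ * C * B₂) * (D * ‖u - v‖) := by gcongr; exact hD _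
    _ = _ := by ring

theorem isClosed_bergmanSpace {G : Set E3} [IsFiniteMeasure (volume.restrict G)]
    (A : Fin 4 → Linf G) : IsClosed (bergmanSpace A : Set (L2 G)) := by
  have h : (bergmanSpace A : Set (L2 G))
      = ⋂ (φ : E3 → BiQ) (_ : IsTest G φ), {w | weakDefect A φ w = 0} := by
    ext w
    simp only [SetLike.mem_coe, mem_bergmanSpace, IsWeakDirac, Set.mem_iInter, Set.mem_ofPred_eq,
      weakDefect, sub_eq_zero]
  rw [h]
  exact isClosed_iInter fun φ => isClosed_iInter fun hφ =>
    isClosed_eq (continuous_weakDefect A hφ) continuous_const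

/-! ### Continuous representatives and point evaluation -/

/-- Local representatives agree on overlaps, because continuous functions equal almost everywhere on
an open set coincide there. The diagonal `x ↦ f x x` therefore glues them, and a locally null
exceptional set is null. -/
theorem exists_isContRep_of_local {G : Set E3} (hGo : IsOpen G) (w : L2 G)
    (h : ∀ x₀ ∈ G, ∃ ρ > 0, Metric.ball x₀ ρ ⊆ G ∧
      ∃ f : E3 → BiQ, Continuous f ∧ ∀ᵐ x, x ∈ Metric.ball x₀ ρ → w x = f x) :
    ∃ f, IsContRep G w f := by
  choose! ρ hρ hρG f hf hwf using h
  have agree : ∀ x₀ ∈ G, ∀ x ∈ Metric.ball x₀ (ρ x₀), f x x = f x₀ x := by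
    intro x₀ hx₀ x hx
    have hxG : x ∈ G := hρG x₀ hx₀ hx
    refine Measure.eqOn_open_of_ae_eq (μ := volume)
      (U := Metric.ball x (ρ x) ∩ Metric.ball x₀ (ρ x₀)) ?_ (Metric.isOpen_ball.inter
        Metric.isOpen_ball) (hf x hxG).continuousOn (hf x₀ hx₀).continuousOn
      ⟨Metric.mem_ball_self (hρ x hxG), hx⟩
    refine (ae_restrict_iff' (measurableSet_ball.inter measurableSet_ball)).2 ?_
    filter_upwards [hwf x hxG, hwf x₀ hx₀] with y h1 h2 hy
    rw [← h1 hy.1, ← h2 hy.2]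
  refine ⟨fun x => f x x, fun x₀ hx₀ => ?_, ?_⟩
  · refine ((hf x₀ hx₀).continuousAt.congr ?_).continuousWithinAt
    filter_upwards [Metric.ball_mem_nhds x₀ (hρ x₀ hx₀)] with x hx using (agree x₀ hx₀ x hx).symm
  · refine (ae_restrict_iff' hGo.measurableSet).2 ?_
    refine measure_null_of_locally_null _ fun x₀ hx₀ => ?_
    have hx₀G : x₀ ∈ G := by
      by_contra hn
      exact hx₀ fun h => absurd h hn
    refine ⟨_, inter_mem_nhdsWithin _ (Metric.ball_mem_nhds x₀ (hρ x₀ hx₀G)),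
      measure_mono_null ?_ (hwf x₀ hx₀G)⟩
    rintro x ⟨hx1, hx2⟩ hx3
    exact hx1 fun _ => (hx3 hx2).trans (agree x₀ hx₀G x hx2).symm

theorem isContRep_value {G : Set E3} {w : L2 G} (h : ∃ f, IsContRep G w f) :
    IsContRep G w (value w) := by
  have e : value w = h.choose := funext fun x => by rw [value, dif_pos h]
  rw [e]
  exact h.choose_spec

theorem value_add {G : Set E3} (hGo : IsOpen G) {u v : L2 G} (hu : ∃ f, IsContRep G u f)
    (hv : ∃ f, IsContRep G v f) {x : E3} (hx : x ∈ G) :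
    value (u + v) x = value u x + value v x := by
  have hu' := isContRep_value hu
  have hv' := isContRep_value hv
  exact value_eq hGo (f := fun x => value u x + value v x)
    ⟨hu'.1.add hv'.1, (Lp.coeFn_add u v).trans (hu'.2.add hv'.2)⟩ hx

theorem value_smul {G : Set E3} (hGo : IsOpen G) (c : ℂ) {u : L2 G} (hu : ∃ f, IsContRep G u f)
    {x : E3} (hx : x ∈ G) : value (c • u) x = c • value u x := by
  have hu' := isContRep_value hu
  exact value_eq hGo (f := fun x => c • value u x)
    ⟨hu'.1.const_smul c, (Lp.coeFn_smul c u).trans (hu'.2.const_smul c)⟩ hx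

theorem norm_value_le_of_ae {G : Set E3} {w : L2 G} (hw : ∃ f, IsContRep G w f) {U : Set E3}
    (hU : IsOpen U) (hUG : U ⊆ G) {M : ℝ} (h : ∀ᵐ x, x ∈ U → ‖w x‖ ≤ M) {x : E3} (hx : x ∈ U) :
    ‖value w x‖ ≤ M := by
  have hw' := isContRep_value hw
  -- The inequality is rewritten as `max ‖w‖ M = M`, an equality of continuous functions, which
  -- extends from almost every point to every point of an open set.
  have key : Set.EqOn (fun x => max ‖value w x‖ M) (fun _ => M) U := by
    refine Measure.eqOn_open_of_ae_eq (μ := volume) ?_ hU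
      ((hw'.1.mono hUG).norm.sup continuousOn_const) continuousOn_const
    filter_upwards [ae_restrict_of_ae_restrict_of_subset hUG hw'.2,
      (ae_restrict_iff' hU.measurableSet).2 h] with y h1 h2
    rw [← h1]
    exact max_eq_right h2
  exact max_eq_right_iff.1 (key hx)

/-- Pointwise evaluation on a space of classes with continuous representatives is linear. -/
def evalLin {G : Set E3} (hGo : IsOpen G) {A : Fin 4 → Linf G}
    (hrep : ∀ w : bergmanSpace A, ∃ f, IsContRep G (w : L2 G) f) {x : E3} (hx : x ∈ G) :
    bergmanSpace A →ₗ[ℂ] BiQ where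
  toFun w := value (w : L2 G) x
  map_add' u v := value_add hGo (hrep u) (hrep v) hx
  map_smul' c u := value_smul hGo c (hrep u) hx

theorem evalLin_apply {G : Set E3} (hGo : IsOpen G) {A : Fin 4 → Linf G}
    (hrep : ∀ w : bergmanSpace A, ∃ f, IsContRep G (w : L2 G) f) {x : E3} (hx : x ∈ G)
    (w : bergmanSpace A) : evalLin hGo hrep hx w = value (w : L2 G) x := rfl

theorem existsUnique_represents {G : Set E3} (hGo : IsOpen G) {A : Fin 4 → Linf G}
    [CompleteSpace (bergmanSpace A)]
    (hrep : ∀ w : bergmanSpace A, ∃ f, IsContRep G (w : L2 G) f) {x : E3} (hx : x ∈ G) {C : ℝ}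
    (hC : ∀ w : bergmanSpace A, ‖value (w : L2 G) x‖ ≤ C * ‖w‖) (k : Fin 4) :
    ∃! K : bergmanSpace A, Represents A x k K := by
  let L : bergmanSpace A →L[ℂ] ℂ :=
    (EuclideanSpace.proj k : BiQ →L[ℂ] ℂ).comp ((evalLin hGo hrep hx).mkContinuous C hC)
  have hL : ∀ w, L w = value (w : L2 G) x k := fun w => rfl
  have hK : Represents A x k ((InnerProductSpace.toDual ℂ (bergmanSpace A)).symm L) := fun w => by
    rw [InnerProductSpace.toDual_symm_apply, hL]
  exact ⟨_, hK, fun K' hK' => ext_inner_right ℂ fun w => by rw [← hK' w, ← hK w]⟩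

theorem represents_repKernel {G : Set E3} {A : Fin 4 → Linf G} {x : E3} {k : Fin 4}
    (h : ∃ K, Represents A x k K) : Represents A x k (repKernel A x k) := by
  rw [repKernel, dif_pos h]
  exact h.choose_spec

theorem exists_norm_value_le_of_isCompact {G : Set E3} {A : Fin 4 → Linf G}
    (h : ∀ x₀ ∈ G, ∃ ρ > 0, ∃ C : ℝ, ∀ w : bergmanSpace A, ∀ x ∈ Metric.ball x₀ ρ,
      ‖value (w : L2 G) x‖ ≤ C * ‖w‖) {C : Set E3} (hC : IsCompact C) (hCG : C ⊆ G) :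
    ∃ M : ℝ, ∀ w : bergmanSpace A, ∀ x ∈ C, ‖value (w : L2 G) x‖ ≤ M * ‖w‖ := by
  refine hC.induction_on (p := fun S => ∃ M : ℝ, ∀ w : bergmanSpace A, ∀ x ∈ S,
    ‖value (w : L2 G) x‖ ≤ M * ‖w‖) ⟨0, fun _ _ hx => hx.elim⟩ ?_ ?_ ?_
  · rintro s t hst ⟨M, hM⟩
    exact ⟨M, fun w x hx => hM w x (hst hx)⟩
  · rintro s t ⟨M, hM⟩ ⟨N, hN⟩
    refine ⟨max M N, fun w x hx => ?_⟩
    rcases hx with hx | hx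
    · exact (hM w x hx).trans (by gcongr; exact le_max_left _ _)
    · exact (hN w x hx).trans (by gcongr; exact le_max_right _ _)
  · intro x hx
    obtain ⟨ρ, hρ, M, hM⟩ := h x (hCG hx)
    exact ⟨_, mem_nhdsWithin_of_mem_nhds (Metric.ball_mem_nhds x hρ), M, hM⟩

/-- Both sides equal `∑ a_j conj(w_j(t))`: by the reproducing property `conj(w_j(t)) = conj ⟪K_t^j,
w⟫ = ⟪w, K_t^j⟫`. For `w = φ_n` this identifies the coefficients of the expansion. -/
theorem inner_value_eq_inner {G : Set E3} {A : Fin 4 → Linf G} {t : E3}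
    (hK : ∀ k, Represents A t k (repKernel A t k)) (w : bergmanSpace A) (a : BiQ) :
    inner ℂ (value (w : L2 G) t) a = inner ℂ w (∑ j, a j • repKernel A t j) := by
  rw [inner_sum, PiLp.inner_apply]
  refine Finset.sum_congr rfl fun j _ => ?_
  have e := inner_smul_right (𝕜 := ℂ) w (repKernel A t j) (a j)
  rw [e, ← inner_conj_symm w (repKernel A t j), ← hK j w, RCLike.inner_apply]

end Vekua

end

/-! ### The kernel expansion -/

theorem mainTheorem10 {G : Set Vekua.E3} (hGo : IsOpen G) (hGc : IsConnected G)
    (hGb : Bornology.IsBounded G) (A : Fin 4 → Vekua.Linf G) :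
    -- elements of the Bergman space have continuous representatives
    (∀ w : Vekua.bergmanSpace A, ∃ f, Vekua.IsContRep G (w : Vekua.L2 G) f) ∧
    -- the kernels `K_x^k` exist and are unique
    (∀ x ∈ G, ∀ k : Fin 4, ∃! K : Vekua.bergmanSpace A, Vekua.Represents A x k K) ∧
    -- the expansion
    ∀ {ι : Type*} (φ : HilbertBasis ι ℂ (Vekua.bergmanSpace A)), ∀ t ∈ G, ∀ a : Vekua.BiQ,
      MemLp (fun x => Vekua.bergmanKernel A x t a) 2 (volume.restrict G) ∧
      Tendsto (fun s : Finset ι =>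
          eLpNorm (fun x => Vekua.bergmanKernel A x t a
            - ∑ n ∈ s, inner ℂ (Vekua.value (φ n : Vekua.L2 G) t) a
                • Vekua.value (φ n : Vekua.L2 G) x) 2 (volume.restrict G))
        atTop (𝓝 0) ∧
      (∀ C : Set Vekua.E3, IsCompact C → C ⊆ G →
        TendstoUniformlyOn
          (fun (s : Finset ι) (x : Vekua.E3) =>
            ∑ n ∈ s, inner ℂ (Vekua.value (φ n : Vekua.L2 G) t) a
              • Vekua.value (φ n : Vekua.L2 G) x)
          (fun x => Vekua.bergmanKernel A x t a) atTop C) := by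
  open Vekua in
  have : IsFiniteMeasure (volume.restrict G) :=
    isFiniteMeasure_restrict.2 hGb.measure_lt_top.ne
  obtain ⟨R, hR⟩ : ∃ R : ℝ, ∀ x ∈ G, ∀ y ∈ G, ‖x - y‖ < R := by
    obtain ⟨R, hR⟩ := Metric.isBounded_iff.1 hGb
    exact ⟨R + 1, fun x hx y hy => by
      rw [← dist_eq_norm]
      exact (hR hx hy).trans_lt (lt_add_one R)⟩
  have hrep : ∀ w : bergmanSpace A, ∃ f, IsContRep G (w : L2 G) f := fun w =>
    exists_isContRep_of_local hGo w fun x₀ hx₀ => by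
      obtain ⟨ρ, hρ, hρG, C, -, h⟩ := bergman_local_regularity hGo hR A hx₀
      exact ⟨ρ, hρ, hρG, (h w w.2).2⟩
  have hbd : ∀ x₀ ∈ G, ∃ ρ > 0, ∃ C : ℝ, ∀ w : bergmanSpace A, ∀ x ∈ Metric.ball x₀ ρ,
      ‖value (w : L2 G) x‖ ≤ C * ‖w‖ := by
    intro x₀ hx₀
    obtain ⟨ρ, hρ, hρG, C, -, h⟩ := bergman_local_regularity hGo hR A hx₀
    exact ⟨ρ, hρ, C, fun w x hx =>
      norm_value_le_of_ae (hrep w) Metric.isOpen_ball hρG (h w w.2).1 hx⟩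
  have : CompleteSpace (bergmanSpace A) := (isClosed_bergmanSpace A).completeSpace_coe
  have huniq : ∀ x ∈ G, ∀ k : Fin 4, ∃! K : bergmanSpace A, Represents A x k K := by
    intro x hx k
    obtain ⟨ρ, hρ, C, hC⟩ := hbd x hx
    exact existsUnique_represents hGo hrep hx (fun w => hC w x (Metric.mem_ball_self hρ)) k
  refine ⟨hrep, huniq, fun {ι} φ t ht a => ?_⟩
  have hK : ∀ k, Represents A t k (repKernel A t k) := fun k =>
    represents_repKernel (huniq t ht k).exists
  set K : bergmanSpace A := ∑ j, a j • repKernel A t j with hKdef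
  let P : Finset ι → bergmanSpace A := fun s =>
    ∑ n ∈ s, inner ℂ (value (φ n : L2 G) t) a • φ n
  -- Convergence of a Hilbert basis expansion is along the net of finite partial sums, so it is
  -- unconditional from the outset.
  have hP : Tendsto P atTop (𝓝 K) := by
    have h := φ.hasSum_repr K
    simp only [φ.repr_apply_apply, hKdef, ← inner_value_eq_inner hK] at h
    exact h
  have hKx : ∀ x ∈ G, bergmanKernel A x t a = value (K : L2 G) x := by
    intro x hx
    rw [← evalLin_apply hGo hrep hx, hKdef, map_sum]
    simp only [map_smul, evalLin_apply]
    rfl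
  have hPx : ∀ x ∈ G, ∀ s, ∑ n ∈ s, inner ℂ (value (φ n : L2 G) t) a • value (φ n : L2 G) x
      = value (P s : L2 G) x := by
    intro x hx s
    rw [← evalLin_apply hGo hrep hx (P s), map_sum]
    simp only [map_smul, evalLin_apply]
  -- The remainder is again the evaluation of an element of the Bergman space, so both modes of
  -- convergence reduce to `‖K - P s‖ → 0`.
  have hdiff : ∀ x ∈ G, ∀ s, bergmanKernel A x t a
      - ∑ n ∈ s, inner ℂ (value (φ n : L2 G) t) a • value (φ n : L2 G) x
      = value ((K - P s : bergmanSpace A) : L2 G) x := by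
    intro x hx s
    rw [hKx x hx, hPx x hx s, ← evalLin_apply hGo hrep hx, ← evalLin_apply hGo hrep hx,
      ← evalLin_apply hGo hrep hx, map_sub]
  have hnorm : Tendsto (fun s => ‖K - P s‖) atTop (𝓝 0) := by
    simpa using (hP.const_sub K).norm
  refine ⟨?_, ?_, fun C hC hCG => ?_⟩
  · refine (Lp.memLp (K : L2 G)).ae_eq ?_
    filter_upwards [(isContRep_value (hrep K)).2, ae_restrict_mem hGo.measurableSet] with x h1 hx
    rw [h1, hKx x hx]
  · have e : ∀ s, eLpNorm (fun x => bergmanKernel A x t a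
        - ∑ n ∈ s, inner ℂ (value (φ n : L2 G) t) a • value (φ n : L2 G) x) 2 (volume.restrict G)
        = ENNReal.ofReal ‖K - P s‖ := by
      intro s
      rw [Submodule.coe_norm, ofReal_norm, Lp.enorm_def]
      refine eLpNorm_congr_ae ?_
      filter_upwards [(isContRep_value (hrep (K - P s))).2, ae_restrict_mem hGo.measurableSet]
        with x h1 hx
      rw [h1, hdiff x hx s]
    simp_rw [e]
    simpa using ENNReal.tendsto_ofReal hnorm
  · obtain ⟨M, hM⟩ := exists_norm_value_le_of_isCompact hbd hC hCG
    refine Metric.tendstoUniformlyOn_iff.2 fun ε hε => ?_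
    have h0 : Tendsto (fun s => M * ‖K - P s‖) atTop (𝓝 0) := by simpa using hnorm.const_mul M
    filter_upwards [h0.eventually_lt_const hε] with s hs x hx
    rw [dist_eq_norm, hdiff x (hCG hx) s]
    exact (hM _ x hx).trans_lt hs
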